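/- For $q\ge 2$, a graph $H_q$ (generalized hexagon of order $q$) means a bipartite Moore graph of degree $q+1$ and diameter $6$, that is, a $(q+1)$-regular bipartite graph of diameter $6$ with $2(1+q+\dots+q^5)=2\frac{q^6-1}{q-1}$ vertices. A graph $H_q(K_h)$ is a graph obtained from $H_q$ in the following way. Fix a vertex $r$ and a set $S$ of vertices at distance $3$ from $r$; write the vertices at distance $3$ from $r$ as $x_{ijk}$, where $x_{ij}$ at distance $2$ is the parent of $x_{ijk}$ and $x_i$ at distance $1$ is the parent of $x_{ij}$. Replace each $x\in S$ by a complete graph $K_x$ on $h$ vertices, leaving the rest of the graph unchanged, so that every edge $ux$ becomes exactly one edge from $u$ to a vertex of $K_x$, and add some edges between different complete graphs, such that (a) each vertex of $K_x$ is joined to at least one former neighbour of $x$ at distance $4$ from $r$; (b) if $x_{ijk},x_{ijl}\in S$ with $k\ne l$, there is an edge between their complete graphs; (c) if $x_{ijk},x_{imn}\in S$ with $j\ne m$, there is an edge from the complete graph of $x_{ijk}$ to that of some $x_{imn'}\in S$. A compound $G<B$ of a graph $G$ and a connected bipartite graph $B$ is obtained from their disjoint union by joining every vertex of $G$ to exactly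 one vertex of each of the two partite sets of $B$, such that each vertex of $B$ is on at most one new edge. Theorem. Graphs $H_4$ and $H_5$ exist. For any such graphs $H_4$ and $H_5$, it is possible to replace $8$ vertices of $H_4$ by complete graphs $K_4$ as above so as to obtain a graph $H_4(K_4)$ with $2754$ vertices, maximum degree $5$ and diameter $6$, and there is a compound $H_4(K_4)<H_5$ which is a graph with $10\,566$ vertices, maximum degree $7$ and diameter $6$. -/

import Mathlib

/-- The finite graph `G` has order `n`, degree `Δ` (the largest vertex degree is exactly `Δ`)
and diameter exactly `D` (in particular it is connected). -/
def HasOrderDegreeDiameter {V : Type*} (G : SimpleGraph V) (n Δ D : ℕ) : Prop :=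
  Nat.card V = n ∧
  IsGreatest (Set.range fun v : V => (G.neighborSet v).ncard) Δ ∧
  G.ediam = (D : ℕ∞)

/-- `G` is a bipartite Moore graph of degree `Δ` and diameter `D`: a `Δ`-regular bipartite graph
of diameter `D` whose order attains the bound
`2 * (1 + (Δ - 1) + ... + (Δ - 1) ^ (D - 1)) = 2 * ((Δ - 1) ^ D - 1) / (Δ - 2)`. -/
structure IsBipartiteMoore {V : Type*} (G : SimpleGraph V) (Δ D : ℕ) : Prop where
  bipartite : G.IsBipartite
  regular : ∀ v : V, (G.neighborSet v).ncard = Δ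
  diameter : G.ediam = (D : ℕ∞)
  order : Nat.card V = 2 * ∑ i ∈ Finset.range D, (Δ - 1) ^ i

/-- `G` is (the incidence graph of) a generalized hexagon of order `q`, i.e. a graph `H_q`:
a bipartite Moore graph of degree `q + 1` and diameter `6`. -/
def IsGeneralizedHexagon (q : ℕ) {V : Type*} (G : SimpleGraph V) : Prop :=
  IsBipartiteMoore G (q + 1) 6

/-- For vertices `x = x_{ijk}` and `y = x_{mnl}` at distance `3` from the root `r`
of the tree of shortest paths: `x` and `y` have the same parent, i.e. `(i, j) = (m, n)`. -/
def SameParent {V : Type*} (H : SimpleGraph V) (r x y : V) : Prop :=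
  ∃ w, H.dist r w = 2 ∧ H.Adj w x ∧ H.Adj w y

/-- For vertices `x = x_{ijk}` and `y = x_{mnl}` at distance `3` from the root `r`
of the tree of shortest paths: `x` and `y` have the same grandparent, i.e. `i = m`. -/
def SameGrandparent {V : Type*} (H : SimpleGraph V) (r x y : V) : Prop :=
  ∃ w, H.Adj r w ∧ H.dist w x = 2 ∧ H.dist w y = 2

/-- `G` arises from `H` by replacing every vertex `x` of a set `S` of vertices at distance `3`
from a root `r` by a complete graph `K_x` on the `h` vertices `(x, 0), ..., (x, h - 1)`.
The rest of `H` is unchanged, every edge `u x` of `H` becomes one edge from `u` to `K_x`, and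
new edges are put between different complete graphs only. -/
structure IsSubstitution {V : Type*} (H : SimpleGraph V) (r : V) (S : Set V) (h : ℕ)
    (G : SimpleGraph ({v : V // v ∉ S} ⊕ S × Fin h)) : Prop where
  depth : ∀ x ∈ S, H.dist r x = 3
  old : ∀ u v : {v : V // v ∉ S}, G.Adj (Sum.inl u) (Sum.inl v) ↔ H.Adj u v
  complete : ∀ (x : S) (a b : Fin h), G.Adj (Sum.inr (x, a)) (Sum.inr (x, b)) ↔ a ≠ b
  attached : ∀ (u : {v : V // v ∉ S}) (x : S) (a : Fin h),
    G.Adj (Sum.inl u) (Sum.inr (x, a)) → H.Adj u x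
  reattach : ∀ (u : {v : V // v ∉ S}) (x : S), H.Adj u x →
    ∃! a : Fin h, G.Adj (Sum.inl u) (Sum.inr (x, a))
  /-- Each vertex of `K_x` is joined to a former neighbour of `x` other than the parent of `x`. -/
  outward : ∀ (x : S) (a : Fin h), ∃ u : {v : V // v ∉ S},
    H.dist r u = 4 ∧ G.Adj (Sum.inl u) (Sum.inr (x, a))
  /-- There is an edge between `K_{ijk}` and `K_{ijl}` for `k ≠ l`. -/
  siblings : ∀ x y : S, x ≠ y → SameParent H r x y →
    ∃ a b : Fin h, G.Adj (Sum.inr (x, a)) (Sum.inr (y, b))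
  /-- For `j ≠ m` there is an edge from `K_{ijk}` to some `K_{imn}`. -/
  cousins : ∀ x y : S, SameGrandparent H r x y → ¬ SameParent H r x y →
    ∃ z : S, SameParent H r y z ∧ ∃ a b : Fin h, G.Adj (Sum.inr (x, a)) (Sum.inr (z, b))

/-- `C` is a compound `G < B` of a graph `G` and a bipartite graph `B`: the disjoint union of `G`
and `B`, together with new edges joining every vertex of `G` to exactly one vertex of each partite
set of `B`, such that each vertex of `B` is on at most one new edge. -/
structure IsCompound {V W : Type*} (G : SimpleGraph V) (B : SimpleGraph W)
    (C : SimpleGraph (V ⊕ W)) : Prop where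
  left : ∀ u v : V, C.Adj (Sum.inl u) (Sum.inl v) ↔ G.Adj u v
  right : ∀ u v : W, C.Adj (Sum.inr u) (Sum.inr v) ↔ B.Adj u v
  join : ∃ c : B.Coloring Bool, ∀ (v : V) (t : Bool),
    ∃! w : W, c w = t ∧ C.Adj (Sum.inl v) (Sum.inr w)
  inj : ∀ (u v : V) (w : W), C.Adj (Sum.inl u) (Sum.inr w) → C.Adj (Sum.inl v) (Sum.inr w) → u = v

/-! Existence. The split Cayley hexagon over a field with `q` elements has order `q`. Its points and
lines are the 1- and 2-dimensional spaces of trace zero split octonions on which the product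
vanishes. The trace zero annihilator of an isotropic `x` is 3-dimensional, so `q + 1` lines pass
through each point (`finrank_annihilator`). On a line `L` some nonzero `w` satisfies `tr (x w) = 0`,
and then `x w`, if nonzero, is a point collinear with both `x` and `w`, so a point and a line are at
distance at most 5 (`near_five_splitCayley`). Counting the `q ^ 6` isotropic vectors of trace zero
gives the order. That the diameter is not smaller follows here, as for the other two graphs, from
the Moore bound (`ediam_eq_six`).

Structure of `H_4`. Attaining the Moore bound forces every vertex at distance at most 5 from a root
to have a single neighbour nearer to the root (`IsGeneralizedHexagon.uniqueLower`). Hence a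
nonbacktracking path that starts to climb away from the root cannot turn back before level 6.

Substitution. The eight replaced vertices are indexed by `ZMod 8`; `t` and `t + 4` share a branch at
the root, parents are distinct, and the fifth branch is left free. In each `K_4` every vertex takes
one child of the replaced vertex; vertex 0 also takes the parent, and the other three take one edge
each to other cliques, forming a Wagner graph. So degrees stay at most 5.

Distances of at most 5 in `H_4` grow by at most 1, because replaced vertices are pairwise at
distance at least 4 and so a geodesic between remaining vertices crosses at most one clique; the one
bad case, starting in a clique, is repaired by the diameter 2 of the Wagner graph. Opposite
remaining vertices are joined by several paths of length 6, one of which meets no replaced vertex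
(`exists_avoiding_path`). From a clique, the path starting at the child in the given slot climbs and
does not return to level 3 before its end.

Compound. Each colour class of `H_5` has 3906 vertices, enough to match all 2754 vertices into both
classes. To go from `v` to a vertex `w` of `H_5`, leave through the neighbour of `v` coloured unlike
`w`: its distance to `w` is odd, hence at most 5. -/

section

open Finset

/-! ### Spheres and the Moore bound -/

section Spheres

variable {V : Type*} [Fintype V]

open Classical in
/-- The set of vertices at distance `i` from `r`. -/
noncomputable def sphereAt (G : SimpleGraph V) (r : V) (i : ℕ) : Finset V :=
  univ.filter fun v => G.dist r v = i

open Classical in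
/-- The neighbours of `v` that are at distance `i` from `r`. -/
noncomputable def nbrsAt (G : SimpleGraph V) (r : V) (i : ℕ) (v : V) : Finset V :=
  univ.filter fun w => G.dist r w = i ∧ G.Adj v w

variable {G : SimpleGraph V} {r : V}

theorem mem_sphereAt {i : ℕ} {v : V} : v ∈ sphereAt G r i ↔ G.dist r v = i := by
  simp [sphereAt]

theorem mem_nbrsAt {i : ℕ} {v w : V} : w ∈ nbrsAt G r i v ↔ G.dist r w = i ∧ G.Adj v w := by
  simp [nbrsAt]

theorem exists_adj_dist_of_dist_eq_succ {V : Type*} {G : SimpleGraph V} {r v : V} {n : ℕ}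
    (h : G.dist r v = n + 1) : ∃ w, G.Adj w v ∧ G.dist r w = n := by
  have hr : G.Reachable r v := SimpleGraph.Reachable.of_dist_ne_zero (by omega)
  obtain ⟨p, hp⟩ := hr.symm.exists_walk_length_eq_dist
  rw [SimpleGraph.dist_comm, h] at hp
  cases p with
  | nil => simp at hp
  | cons ha q =>
    rename_i w
    refine ⟨w, ha.symm, ?_⟩
    have h1 : G.dist w r ≤ n := by
      have := SimpleGraph.dist_le q
      simp at hp
      omega
    have h2 := ha.symm.diff_dist_adj (u := r)
    rw [SimpleGraph.dist_comm] at h1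
    omega

theorem sum_card_nbrsAt_comm (i j : ℕ) :
    ∑ v ∈ sphereAt G r i, #(nbrsAt G r j v) = ∑ w ∈ sphereAt G r j, #(nbrsAt G r i w) := by
  classical
  have := Finset.sum_card_bipartiteAbove_eq_sum_card_bipartiteBelow (s := sphereAt G r i)
    (t := sphereAt G r j) G.Adj
  refine (Finset.sum_congr rfl fun v hv => ?_).trans (this.trans (Finset.sum_congr rfl fun w hw => ?_))
  · congr 1; ext w; simp [mem_nbrsAt, mem_sphereAt, bipartiteAbove]
  · congr 1; ext v; simp [mem_nbrsAt, mem_sphereAt, bipartiteBelow, G.adj_comm]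

theorem card_nbrsAt_add_le {i j : ℕ} (hij : i ≠ j) (v : V) :
    #(nbrsAt G r i v) + #(nbrsAt G r j v) ≤ (G.neighborSet v).ncard := by
  classical
  rw [← Finset.card_union_of_disjoint, ← Set.ncard_coe_finset]
  · refine Set.ncard_le_ncard (fun w hw => ?_) (Set.toFinite _)
    simp only [coe_union, Set.mem_union, mem_coe, mem_nbrsAt] at hw
    rcases hw with hw | hw <;> exact hw.2
  · rw [Finset.disjoint_left]
    intro w h1 h2
    rw [mem_nbrsAt] at h1 h2
    omega

theorem one_le_card_nbrsAt {i : ℕ} {v : V} (h : G.dist r v = i + 1) : 1 ≤ #(nbrsAt G r i v) := by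
  obtain ⟨w, hw, hd⟩ := exists_adj_dist_of_dist_eq_succ h
  exact Finset.card_pos.2 ⟨w, mem_nbrsAt.2 ⟨hd, hw.symm⟩⟩

/-- Each vertex at level `i + 1` uses at least one of its `d + 1` edges downwards. The left side
counts the edges between consecutive levels rather than the vertices, so that equality forces unique
lower neighbours. -/
theorem sum_card_lower_le {d i : ℕ} (hdeg : ∀ v, (G.neighborSet v).ncard ≤ d + 1) :
    ∑ w ∈ sphereAt G r (i + 2), #(nbrsAt G r (i + 1) w) ≤ d * #(sphereAt G r (i + 1)) := by
  rw [← sum_card_nbrsAt_comm, mul_comm]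
  refine Finset.sum_le_card_nsmul _ _ _ fun v hv => ?_
  have h1 := one_le_card_nbrsAt (mem_sphereAt.1 hv)
  have h2 := card_nbrsAt_add_le (G := G) (r := r) (i := i) (j := i + 2) (by omega) v
  have h3 := hdeg v
  omega

theorem card_sphereAt_succ_le {d i : ℕ} (hdeg : ∀ v, (G.neighborSet v).ncard ≤ d + 1) :
    #(sphereAt G r (i + 2)) ≤ d * #(sphereAt G r (i + 1)) := by
  refine le_trans ?_ (sum_card_lower_le hdeg)
  rw [Finset.card_eq_sum_ones]
  exact Finset.sum_le_sum fun w hw => one_le_card_nbrsAt (mem_sphereAt.1 hw)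

theorem card_sphereAt_one : #(sphereAt G r 1) = (G.neighborSet r).ncard := by
  rw [← Set.ncard_coe_finset]
  congr 1
  ext v
  simp [mem_sphereAt, SimpleGraph.dist_eq_one_iff_adj]

theorem card_sphereAt_zero (hG : G.Connected) : #(sphereAt G r 0) = 1 := by
  rw [Finset.card_eq_one]
  refine ⟨r, ?_⟩
  ext v
  simp [mem_sphereAt, hG.dist_eq_zero_iff, eq_comm]

theorem card_eq_sum_sphereAt {D : ℕ} (hD : ∀ v, G.dist r v ≤ D) :
    Fintype.card V = ∑ i ∈ range (D + 1), #(sphereAt G r i) := by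
  classical
  rw [← Finset.card_univ, Finset.card_eq_sum_card_fiberwise (f := G.dist r) (t := range (D + 1))]
  · rfl
  · intro v _
    simpa using Nat.lt_succ_of_le (hD v)

end Spheres

theorem connected_of_ediam_eq {V : Type*} {G : SimpleGraph V} {D : ℕ} [Nonempty V]
    (h : G.ediam ≤ (D : ℕ∞)) : G.Connected :=
  SimpleGraph.connected_of_ediam_ne_top (ne_top_of_le_ne_top (ENat.natCast_ne_top D) h)

theorem dist_le_of_ediam_le {V : Type*} {G : SimpleGraph V} {D : ℕ}
    (h : G.ediam ≤ (D : ℕ∞)) (u v : V) : G.dist u v ≤ D := by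
  have h1 : G.edist u v ≤ D := SimpleGraph.edist_le_ediam.trans h
  exact ENat.toNat_le_of_le_natCast h1

/-- A finite graph with maximum degree at most `d + 1` and too many vertices for diameter `5`. -/
theorem not_ediam_le_five {V : Type*} [Finite V] {G : SimpleGraph V} {d k : ℕ} (r : V)
    (hdeg : ∀ v, (G.neighborSet v).ncard ≤ d + 1) (hr : (G.neighborSet r).ncard ≤ k)
    (hc : 1 + k * (1 + d + d ^ 2 + d ^ 3 + d ^ 4) < Nat.card V) : ¬ G.ediam ≤ (5 : ℕ) := by
  intro h
  have := Fintype.ofFinite V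
  have : Nonempty V := ⟨r⟩
  have hconn := connected_of_ediam_eq h
  have h0 := card_eq_sum_sphereAt (G := G) (r := r) (dist_le_of_ediam_le h r)
  simp only [Finset.sum_range_succ, Finset.sum_range_zero] at h0
  rw [card_sphereAt_zero hconn, card_sphereAt_one] at h0
  have h2 := card_sphereAt_succ_le (G := G) (r := r) (i := 0) hdeg
  have h3 := card_sphereAt_succ_le (G := G) (r := r) (i := 1) hdeg
  have h4 := card_sphereAt_succ_le (G := G) (r := r) (i := 2) hdeg
  have h5 := card_sphereAt_succ_le (G := G) (r := r) (i := 3) hdeg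
  simp only [zero_add, Nat.reduceAdd] at h2 h3 h4 h5
  rw [card_sphereAt_one] at h2
  rw [Nat.card_eq_fintype_card] at hc
  have e2 : #(sphereAt G r 2) ≤ k * d := by nlinarith
  have e3 : #(sphereAt G r 3) ≤ k * d ^ 2 := h3.trans (by nlinarith [Nat.mul_le_mul_left d e2])
  have e4 : #(sphereAt G r 4) ≤ k * d ^ 3 := h4.trans (by nlinarith [Nat.mul_le_mul_left d e3])
  have e5 : #(sphereAt G r 5) ≤ k * d ^ 4 := h5.trans (by nlinarith [Nat.mul_le_mul_left d e4])
  nlinarith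

/-- The degree bound `k` of the root is kept apart from `d + 1` for the sake of the compound: a root
of degree 7 would allow 10886 vertices within distance 5, a root of degree 6 only 9331. -/
theorem ediam_eq_six {V : Type*} [Finite V] {G : SimpleGraph V} {d k : ℕ} (r : V)
    (hdeg : ∀ v, (G.neighborSet v).ncard ≤ d + 1) (hr : (G.neighborSet r).ncard ≤ k)
    (hc : 1 + k * (1 + d + d ^ 2 + d ^ 3 + d ^ 4) < Nat.card V)
    (hle : ∀ u v, G.edist u v ≤ (6 : ℕ)) : G.ediam = (6 : ℕ) := by
  refine le_antisymm (SimpleGraph.ediam_le_of_edist_le hle) ?_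
  have h := not_ediam_le_five r hdeg hr hc
  rw [not_le] at h
  exact Order.add_one_le_of_lt h

/-! ### Distances in bipartite graphs -/

theorem even_dist_iff {V : Type*} {G : SimpleGraph V} (hG : G.Connected) (c : G.Coloring Bool)
    (u v : V) : Even (G.dist u v) ↔ (c u = c v) := by
  obtain ⟨p, hp⟩ := hG.exists_walk_length_eq_dist u v
  rw [← hp, c.even_length_iff_congr p]
  exact Bool.eq_iff_iff.symm

theorem dist_adj_eq {V : Type*} {G : SimpleGraph V} (hG : G.Connected) (c : G.Coloring Bool)
    (r : V) {u v : V} (h : G.Adj u v) :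
    G.dist r v = G.dist r u + 1 ∨ G.dist r u = G.dist r v + 1 := by
  have h1 := h.diff_dist_adj (u := r)
  have h2 := even_dist_iff hG c r u
  have h3 := even_dist_iff hG c r v
  have h4 := c.valid h
  rcases h1 with h1 | h1 | h1
  · exfalso
    rw [h1, h2] at h3
    revert h3 h4
    generalize c r = a
    generalize c u = b
    generalize c v = e
    revert a b e
    decide
  · exact Or.inl h1
  · by_cases h0 : G.dist r u = 0
    · exfalso
      rw [show G.dist r v = 0 by omega, ← h0, h2] at h3
      revert h3 h4
      generalize c r = a
      generalize c u = b
      generalize c v = e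
      revert a b e
      decide
    · right; omega

/-! ### Levels in a generalized hexagon of order 4 -/

/-- A vertex within distance `5` of the root has a unique neighbour closer to the root. -/
def UniqueLower {V : Type*} (H : SimpleGraph V) : Prop :=
  ∀ r v w w', H.dist r v ≤ 5 → H.Adj v w → H.Adj v w' →
    H.dist r w < H.dist r v → H.dist r w' < H.dist r v → w = w'

theorem IsBipartiteMoore.finite {V : Type*} {H : SimpleGraph V} {Δ D : ℕ} (hD : D ≠ 0)
    (h : IsBipartiteMoore H Δ D) : Finite V := by
  refine Nat.finite_of_card_ne_zero ?_
  rw [h.order]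
  obtain ⟨n, rfl⟩ := Nat.exists_eq_succ_of_ne_zero hD
  rw [Finset.sum_range_succ']
  simp

theorem IsBipartiteMoore.nonempty {V : Type*} {H : SimpleGraph V} {Δ D : ℕ} (hD : D ≠ 0)
    (h : IsBipartiteMoore H Δ D) : Nonempty V := by
  by_contra hV
  rw [not_nonempty_iff] at hV
  have := h.diameter
  rw [SimpleGraph.ediam_eq_zero_of_subsingleton] at this
  exact hD (by exact_mod_cast this.symm)

theorem IsGeneralizedHexagon.connected {V : Type*} {H : SimpleGraph V} {q : ℕ}
    (h : IsGeneralizedHexagon q H) : H.Connected :=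
  have := IsBipartiteMoore.nonempty (by norm_num) h
  connected_of_ediam_eq h.diameter.le

theorem IsGeneralizedHexagon.coloring {V : Type*} {H : SimpleGraph V} {q : ℕ}
    (h : IsGeneralizedHexagon q H) : Nonempty (H.Coloring Bool) :=
  Nonempty.map (fun c : H.Coloring (Fin 2) =>
    SimpleGraph.Coloring.mk (fun v => c v == 0) fun {v w} hvw => by
      have := c.valid hvw
      revert this
      generalize c v = a
      generalize c w = b
      revert a b
      decide) h.bipartite

/-- The order 2730 equals `1 + 5 + 20 + 80 + 320 + 1280 + 1024`, the sum of the largest possible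
level sizes. So all level bounds are equalities, and a second lower neighbour anywhere up to level 5
would make one strict. -/
theorem IsGeneralizedHexagon.uniqueLower {V : Type*} {H : SimpleGraph V}
    (h : IsGeneralizedHexagon 4 H) : UniqueLower H := by
  have := IsBipartiteMoore.finite (by norm_num) h
  have := Fintype.ofFinite V
  obtain ⟨c⟩ := h.coloring
  have hconn := h.connected
  have hle := dist_le_of_ediam_le h.diameter.le
  intro r v w w' hv hw hw' hlt hlt'
  have hdeg : ∀ v, (H.neighborSet v).ncard ≤ 4 + 1 := fun v => (h.regular v).le
  have h0 := card_eq_sum_sphereAt (G := H) (r := r) (hle r)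
  have horder := h.order
  rw [Nat.card_eq_fintype_card, h0] at horder
  have e1 := card_sphereAt_one (G := H) (r := r)
  rw [h.regular] at e1
  have e0 := card_sphereAt_zero (r := r) hconn
  have hs : ∀ i, #(sphereAt H r (i + 2)) ≤ 4 * #(sphereAt H r (i + 1)) :=
    fun i => card_sphereAt_succ_le hdeg
  -- By bipartiteness all five neighbours of a vertex at level 6 lie at level 5.
  have h6 : 5 * #(sphereAt H r 6) ≤ 4 * #(sphereAt H r 5) := by
    refine le_trans ?_ (sum_card_lower_le (i := 4) hdeg)
    rw [mul_comm, ← smul_eq_mul]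
    refine Finset.card_nsmul_le_sum _ (fun w => #(nbrsAt H r 5 w)) _ fun x hx => ?_
    refine (h.regular x).symm.le.trans ?_
    rw [← Set.ncard_coe_finset]
    refine Set.ncard_le_ncard (fun y hy => ?_) (Set.toFinite _)
    rw [SimpleGraph.mem_neighborSet] at hy
    simp only [mem_coe, mem_nbrsAt]
    refine ⟨?_, hy⟩
    have := dist_adj_eq hconn c r hy
    have := hle r y
    rw [mem_sphereAt] at hx
    omega
  have k0 := hs 0
  have k1 := hs 1
  have k2 := hs 2
  have k3 := hs 3
  norm_num [Finset.sum_range_succ] at horder k0 k1 k2 k3 e0 e1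
  have hd := dist_adj_eq hconn c r hw
  have hd' := dist_adj_eq hconn c r hw'
  obtain ⟨n, hn⟩ : ∃ n, H.dist r v = n + 1 := ⟨H.dist r v - 1, by omega⟩
  rcases Nat.eq_zero_or_pos n with rfl | hpos
  · have a1 : H.dist r w = 0 := by omega
    have a2 : H.dist r w' = 0 := by omega
    rw [hconn.dist_eq_zero_iff] at a1 a2
    exact a1.symm.trans a2
  obtain ⟨i, rfl⟩ : ∃ i, n = i + 1 := ⟨n - 1, by omega⟩
  have heq : #(sphereAt H r (i + 2)) = 4 * #(sphereAt H r (i + 1)) := by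
    have : i = 0 ∨ i = 1 ∨ i = 2 ∨ i = 3 := by omega
    rcases this with rfl | rfl | rfl | rfl <;> norm_num <;> omega
  have hsum := sum_card_lower_le (r := r) (i := i) hdeg
  rw [← heq, Finset.card_eq_sum_ones] at hsum
  have hone : ∀ x ∈ sphereAt H r (i + 2), 1 ≤ #(nbrsAt H r (i + 1) x) :=
    fun x hx => one_le_card_nbrsAt (mem_sphereAt.1 hx)
  have hall := (Finset.sum_eq_sum_iff_of_le hone).1 (le_antisymm (Finset.sum_le_sum hone) hsum)
  have hv1 := (hall v (mem_sphereAt.2 hn)).symm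
  exact Finset.card_le_one.1 hv1.le w (mem_nbrsAt.2 ⟨by omega, hw⟩) w' (mem_nbrsAt.2 ⟨by omega, hw'⟩)

end

/-! ### Local structure of a generalized hexagon of order 4 -/

section Levels

variable {V : Type*} {H : SimpleGraph V}

theorem exists_lower {r v : V} {n : ℕ} (h : H.dist r v = n + 1) :
    ∃ w, H.Adj v w ∧ H.dist r w = n := by
  obtain ⟨w, hw, hd⟩ := exists_adj_dist_of_dist_eq_succ h
  exact ⟨w, hw.symm, hd⟩

/-- The neighbours of `v` further away from `r`. -/
def children (H : SimpleGraph V) (r v : V) : Set V := {u | H.Adj v u ∧ H.dist r u = H.dist r v + 1}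

theorem IsGeneralizedHexagon.ncard_children (h : IsGeneralizedHexagon 4 H) {r v : V}
    (h1 : 1 ≤ H.dist r v) (h5 : H.dist r v ≤ 5) : (children H r v).ncard = 4 := by
  have := IsBipartiteMoore.finite (by norm_num) h
  obtain ⟨c⟩ := h.coloring
  have hconn := h.connected
  obtain ⟨n, hn⟩ : ∃ n, H.dist r v = n + 1 := ⟨H.dist r v - 1, by omega⟩
  obtain ⟨w, hw, hd⟩ := exists_lower hn
  have hset : children H r v = H.neighborSet v \ {w} := by
    ext u
    simp only [children, Set.mem_ofPred_eq, Set.mem_sdiff, SimpleGraph.mem_neighborSet,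
      Set.mem_singleton_iff]
    refine ⟨fun ⟨hu, hdu⟩ => ⟨hu, ?_⟩, fun ⟨hu, hne⟩ => ⟨hu, ?_⟩⟩
    · rintro rfl; omega
    · rcases dist_adj_eq hconn c r hu with h' | h'
      · exact h'
      · exact absurd (h.uniqueLower r v u w h5 hu hw (by omega) (by omega)) hne
  rw [hset, Set.ncard_sdiff_singleton_of_mem (by exact hw), h.regular]

theorem IsGeneralizedHexagon.level_cases (h : IsGeneralizedHexagon 4 H) (r : V) {u v : V}
    (huv : H.Adj u v) : H.dist r u ≤ 6 ∧ H.dist r v ≤ 6 ∧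
      (H.dist r v = H.dist r u + 1 ∨ H.dist r u = H.dist r v + 1) := by
  obtain ⟨c⟩ := h.coloring
  have hle := dist_le_of_ediam_le h.diameter.le
  exact ⟨hle r u, hle r v, dist_adj_eq h.connected c r huv⟩

/-- A path with no backtracking can turn around only at level `6`. -/
theorem IsGeneralizedHexagon.no_peak (h : IsGeneralizedHexagon 4 H) (r : V) {u v w : V}
    (huv : H.Adj u v) (hvw : H.Adj v w) (hne : u ≠ w) :
    ¬ (H.dist r v ≤ 5 ∧ H.dist r u < H.dist r v ∧ H.dist r w < H.dist r v) :=
  fun ⟨h5, h1, h2⟩ => hne (h.uniqueLower r v u w h5 huv.symm hvw h1 h2)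

/-- A path `v, p₁, ..., p₅, w` between opposite vertices, all of whose levels are recorded. -/
structure HexPath (H : SimpleGraph V) (v p₁ p₂ p₃ p₄ p₅ w : V) : Prop where
  a₀ : H.Adj v p₁
  a₁ : H.Adj p₁ p₂
  a₂ : H.Adj p₂ p₃
  a₃ : H.Adj p₃ p₄
  a₄ : H.Adj p₄ p₅
  a₅ : H.Adj p₅ w
  opp : H.dist v w = 6

namespace HexPath

variable {v p₁ p₂ p₃ p₄ p₅ w : V}

theorem symm (p : HexPath H v p₁ p₂ p₃ p₄ p₅ w) : HexPath H w p₅ p₄ p₃ p₂ p₁ v :=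
  ⟨p.a₅.symm, p.a₄.symm, p.a₃.symm, p.a₂.symm, p.a₁.symm, p.a₀.symm,
    by rw [SimpleGraph.dist_comm, p.opp]⟩

theorem dists (p : HexPath H v p₁ p₂ p₃ p₄ p₅ w) :
    H.dist p₁ w = 5 ∧ H.dist p₂ w = 4 ∧ H.dist p₃ w = 3 ∧ H.dist p₄ w = 2 ∧ H.dist p₅ w = 1 ∧
      H.dist v p₅ = 5 ∧ H.dist p₁ p₅ = 4 := by
  obtain ⟨a₀, a₁, a₂, a₃, a₄, a₅, h⟩ := p
  rw [SimpleGraph.dist_comm] at h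
  have b0 := a₀.diff_dist_adj (u := w)
  have b1 := a₁.diff_dist_adj (u := w)
  have b2 := a₂.diff_dist_adj (u := w)
  have b3 := a₃.diff_dist_adj (u := w)
  have b4 := a₄.diff_dist_adj (u := w)
  have b5 := SimpleGraph.dist_eq_one_iff_adj.2 a₅
  rw [SimpleGraph.dist_comm] at b5
  have c0 := a₀.diff_dist_adj (u := v)
  have c1 := a₁.diff_dist_adj (u := v)
  have c2 := a₂.diff_dist_adj (u := v)
  have c3 := a₃.diff_dist_adj (u := v)
  have c4 := a₄.diff_dist_adj (u := v)
  have c5 := a₅.diff_dist_adj (u := v)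
  have d1 := a₁.diff_dist_adj (u := p₁)
  have d2 := a₂.diff_dist_adj (u := p₁)
  have d3 := a₃.diff_dist_adj (u := p₁)
  have d4 := a₄.diff_dist_adj (u := p₁)
  have d5 := a₅.diff_dist_adj (u := p₁)
  rw [SimpleGraph.dist_self] at c0 d1
  rw [SimpleGraph.dist_comm (u := w) (v := v)] at h b0
  simp only [SimpleGraph.dist_comm (u := w)] at b0 b1 b2 b3 b4 b5
  refine ⟨?_, ?_, ?_, ?_, ?_, ?_, ?_⟩ <;> omega

theorem ne (p : HexPath H v p₁ p₂ p₃ p₄ p₅ w) :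
    v ≠ p₂ ∧ p₁ ≠ p₃ ∧ p₂ ≠ p₄ ∧ p₃ ≠ p₅ ∧ p₄ ≠ w := by
  obtain ⟨h1, h2, h3, h4, h5, -, -⟩ := p.dists
  have h0 := p.opp
  refine ⟨?_, ?_, ?_, ?_, ?_⟩ <;> rintro rfl
  · omega
  · omega
  · omega
  · omega
  · simp at h4

end HexPath

theorem IsGeneralizedHexagon.exists_hexPath (h : IsGeneralizedHexagon 4 H) {v u w : V}
    (hvw : H.dist v w = 6) (hu : H.Adj v u) :
    ∃ p₂ p₃ p₄ p₅, HexPath H v u p₂ p₃ p₄ p₅ w := by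
  have h0 := h.level_cases w hu
  have hvw' := hvw
  rw [SimpleGraph.dist_comm] at hvw'
  have hu5 : H.dist w u = 4 + 1 := by omega
  obtain ⟨p₂, a₁, h₂⟩ := exists_lower hu5
  obtain ⟨p₃, a₂, h₃⟩ := exists_lower (n := 3) h₂
  obtain ⟨p₄, a₃, h₄⟩ := exists_lower (n := 2) h₃
  obtain ⟨p₅, a₄, h₅⟩ := exists_lower (n := 1) h₄
  exact ⟨p₂, p₃, p₄, p₅, hu, a₁, a₂, a₃, a₄, (SimpleGraph.dist_eq_one_iff_adj.1 h₅).symm, hvw⟩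

/-- Paths between opposite vertices with different second vertices have different penultimate
vertices. -/
theorem HexPath.eq_of_penultimate_eq (h : IsGeneralizedHexagon 4 H)
    {v w p₁ p₂ p₃ p₄ p₅ q₁ q₂ q₃ q₄ q₅ : V}
    (p : HexPath H v p₁ p₂ p₃ p₄ p₅ w) (q : HexPath H v q₁ q₂ q₃ q₄ q₅ w) (h5 : p₅ = q₅) :
    p₁ = q₁ := by
  subst h5
  have hp := p.dists
  have hq := q.dists
  refine h.uniqueLower p₅ v p₁ q₁ ?_ p.a₀ q.a₀ ?_ ?_ <;>
    simp only [SimpleGraph.dist_comm (u := p₅)] <;> omega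

/-- All constraints on the levels of the vertices of a path between opposite vertices. -/
theorem HexPath.levels (h : IsGeneralizedHexagon 4 H) (r : V) {v p₁ p₂ p₃ p₄ p₅ w : V}
    (p : HexPath H v p₁ p₂ p₃ p₄ p₅ w) {l₀ l₁ l₂ l₃ l₄ l₅ l₆ : ℕ}
    (e₀ : H.dist r v = l₀) (e₁ : H.dist r p₁ = l₁) (e₂ : H.dist r p₂ = l₂) (e₃ : H.dist r p₃ = l₃)
    (e₄ : H.dist r p₄ = l₄) (e₅ : H.dist r p₅ = l₅) (e₆ : H.dist r w = l₆) :
    (l₀ ≤ 6 ∧ l₁ ≤ 6 ∧ l₂ ≤ 6 ∧ l₃ ≤ 6 ∧ l₄ ≤ 6 ∧ l₅ ≤ 6 ∧ l₆ ≤ 6) ∧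
    ((l₁ = l₀ + 1 ∨ l₀ = l₁ + 1) ∧ (l₂ = l₁ + 1 ∨ l₁ = l₂ + 1) ∧ (l₃ = l₂ + 1 ∨ l₂ = l₃ + 1) ∧
    (l₄ = l₃ + 1 ∨ l₃ = l₄ + 1) ∧ (l₅ = l₄ + 1 ∨ l₄ = l₅ + 1) ∧ (l₆ = l₅ + 1 ∨ l₅ = l₆ + 1)) ∧
    (¬ (l₁ ≤ 5 ∧ l₀ < l₁ ∧ l₂ < l₁) ∧ ¬ (l₂ ≤ 5 ∧ l₁ < l₂ ∧ l₃ < l₂) ∧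
    ¬ (l₃ ≤ 5 ∧ l₂ < l₃ ∧ l₄ < l₃) ∧ ¬ (l₄ ≤ 5 ∧ l₃ < l₄ ∧ l₅ < l₄) ∧
    ¬ (l₅ ≤ 5 ∧ l₄ < l₅ ∧ l₆ < l₅)) := by
  subst e₀ e₁ e₂ e₃ e₄ e₅ e₆
  obtain ⟨n1, n2, n3, n4, n5⟩ := p.ne
  have b0 := h.level_cases r p.a₀
  have b1 := h.level_cases r p.a₁
  have b2 := h.level_cases r p.a₂
  have b3 := h.level_cases r p.a₃
  have b4 := h.level_cases r p.a₄
  have b5 := h.level_cases r p.a₅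
  exact ⟨⟨b0.1, b0.2.1, b1.2.1, b2.2.1, b3.2.1, b4.2.1, b5.2.1⟩,
    ⟨b0.2.2, b1.2.2, b2.2.2, b3.2.2, b4.2.2, b5.2.2⟩,
    ⟨h.no_peak r p.a₀ p.a₁ n1, h.no_peak r p.a₁ p.a₂ n2, h.no_peak r p.a₂ p.a₃ n3,
      h.no_peak r p.a₃ p.a₄ n4, h.no_peak r p.a₄ p.a₅ n5⟩⟩

end Levels

/-! ### The set of replaced vertices -/

/-- Eight vertices at distance `3` from the root, two in each of four of the five branches, no two
of which have the same parent. -/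
structure IsReplaceable {V : Type*} (H : SimpleGraph V) (r g : V) (X : ZMod 8 → V) : Prop where
  depth : ∀ t, H.dist r (X t) = 3
  sibling : ∀ s t, SameParent H r (X s) (X t) → s = t
  cousin : ∀ s t, SameGrandparent H r (X s) (X t) → s = t ∨ s = t + 4
  free : H.Adj r g
  free_branch : ∀ t, H.dist g (X t) ≠ 2

theorem IsReplaceable.injective {V : Type*} {H : SimpleGraph V} {r g : V} {X : ZMod 8 → V}
    (hX : IsReplaceable H r g X) : Function.Injective X := by
  intro s t hst
  obtain ⟨w, hw, hd⟩ := exists_lower (n := 2) (hX.depth s)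
  exact hX.sibling s t ⟨w, hd, hw.symm, hst ▸ hw.symm⟩

theorem exists_injective_range_eq {V : Type*} {s : Set V} {n : ℕ} (hs : s.ncard = n)
    (hn : n ≠ 0) : ∃ f : Fin n → V, Function.Injective f ∧ Set.range f = s := by
  have hfin : s.Finite := Set.finite_of_ncard_ne_zero (by omega)
  have := hfin.to_subtype
  have e : s ≃ Fin n := Finite.equivFinOfCardEq hs
  refine ⟨fun i => e.symm i, fun i j hij => e.symm.injective (Subtype.ext hij), ?_⟩
  ext v
  refine ⟨?_, fun hv => ⟨e ⟨v, hv⟩, by simp⟩⟩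
  rintro ⟨i, rfl⟩
  exact (e.symm i).2

theorem IsGeneralizedHexagon.exists_between {V : Type*} {H : SimpleGraph V}
    (h : IsGeneralizedHexagon 4 H) {r w x : V} (hw : H.Adj r w) (hx : H.dist r x = 3)
    (hwx : H.dist w x = 2) : ∃ y, H.Adj w y ∧ H.Adj y x ∧ H.dist r y = 2 := by
  obtain ⟨y, hyx, hy⟩ := exists_adj_dist_of_dist_eq_succ (n := 1) hwx
  rw [SimpleGraph.dist_eq_one_iff_adj] at hy
  refine ⟨y, hy, hyx, ?_⟩
  have h1 := SimpleGraph.dist_eq_one_iff_adj.2 hw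
  have h2 := h.level_cases r hy
  have h3 := h.level_cases r hyx
  omega

theorem IsGeneralizedHexagon.exists_isReplaceable {V : Type*} {H : SimpleGraph V}
    (h : IsGeneralizedHexagon 4 H) (r : V) : ∃ g X, IsReplaceable H r g X := by
  obtain ⟨g, hg, hgr⟩ := exists_injective_range_eq (h.regular r) (by norm_num)
  have hP : ∀ v, ∃ f : Fin 4 → V, 1 ≤ H.dist r v → H.dist r v ≤ 5 →
      Function.Injective f ∧ ∀ i, H.Adj v (f i) ∧ H.dist r (f i) = H.dist r v + 1 := by
    intro v
    by_cases hv : 1 ≤ H.dist r v ∧ H.dist r v ≤ 5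
    · obtain ⟨f, hf, hfr⟩ := exists_injective_range_eq (h.ncard_children hv.1 hv.2) (by norm_num)
      refine ⟨f, fun _ _ => ⟨hf, fun i => ?_⟩⟩
      have : f i ∈ children H r v := hfr ▸ Set.mem_range_self i
      exact this
    · exact ⟨fun _ => v, fun h1 h2 => absurd ⟨h1, h2⟩ hv⟩
  choose P hP using hP
  have hga : ∀ i, H.Adj r (g i) := fun i => by
    have : g i ∈ H.neighborSet r := hgr ▸ Set.mem_range_self i
    exact this
  have hg1 : ∀ i, H.dist r (g i) = 1 := fun i => SimpleGraph.dist_eq_one_iff_adj.2 (hga i)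
  -- `b t` is the branch at the root and `k t` the child of `g (b t)` serving as parent. Only
  -- branches 0 to 3 and children 0 and 1 occur, so `t` and `t + 4` share a branch but not a parent,
  -- and branch 4 stays free.
  let b : ZMod 8 → Fin 5 := fun t => ⟨t.val % 4, by omega⟩
  let k : ZMod 8 → Fin 4 := fun t => ⟨t.val / 4, by have := t.val_lt; omega⟩
  have hbk : ∀ s t, b s = b t → k s = k t → s = t := by decide
  have hb : ∀ s t, b s = b t → s = t ∨ s = t + 4 := by decide
  have hb4 : ∀ t, b t ≠ 4 := by decide
  have hp := fun t => (hP (g (b t)) (by rw [hg1]) (by rw [hg1]; norm_num)).2 (k t)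
  simp only [hg1] at hp
  have hx := fun t => (hP (P (g (b t)) (k t)) (by rw [(hp t).2]; norm_num)
    (by rw [(hp t).2]; norm_num)).2 0
  have hx3 : ∀ t, H.dist r (P (P (g (b t)) (k t)) 0) = 3 := fun t => by rw [(hx t).2, (hp t).2]
  have par : ∀ t w, H.dist r w = 2 → H.Adj w (P (P (g (b t)) (k t)) 0) → w = P (g (b t)) (k t) :=
    fun t w hw ha => h.uniqueLower r _ _ _ (by rw [hx3]; norm_num) ha.symm (hx t).1.symm
      (by rw [hx3, hw]; norm_num) (by rw [hx3, (hp t).2]; norm_num)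
  have gpar : ∀ t w, H.Adj r w → H.Adj w (P (g (b t)) (k t)) → w = g (b t) :=
    fun t w hw ha => h.uniqueLower r _ _ _ (by rw [(hp t).2]; norm_num) ha.symm (hp t).1.symm
      (by rw [(hp t).2, SimpleGraph.dist_eq_one_iff_adj.2 hw]; norm_num)
      (by rw [(hp t).2, hg1]; norm_num)
  have branch : ∀ t w, H.Adj r w → H.dist w (P (P (g (b t)) (k t)) 0) = 2 → w = g (b t) := by
    intro t w hw hd
    obtain ⟨y, hy, hyx, hy2⟩ := h.exists_between hw (hx3 t) hd
    obtain rfl := par t y hy2 hyx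
    exact gpar t w hw hy
  refine ⟨g 4, fun t => P (P (g (b t)) (k t)) 0, hx3, ?_, ?_, hga 4, ?_⟩
  · rintro s t ⟨w, hw, hs, ht⟩
    have e1 := par s w hw hs
    have e2 := par t w hw ht
    have e3 : g (b s) = g (b t) := gpar t _ (hga _) (by rw [← e2, e1]; exact (hp s).1)
    have e4 : b s = b t := hg e3
    refine hbk s t e4 ?_
    have := (hP (g (b t)) (by rw [hg1]) (by rw [hg1]; norm_num)).1
    apply this
    rw [← e2, ← e3, e1]
  · rintro s t ⟨w, hw, hs, ht⟩
    exact hb s t (hg ((branch s w hw hs).symm.trans (branch t w hw ht)))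
  · intro t ht
    exact hb4 t (hg (branch t _ (hga 4) ht)).symm

/-! ### Paths between opposite vertices that avoid the replaced vertices -/

theorem HexPath.eq_of_lower {V : Type*} {H : SimpleGraph V}
    (h : IsGeneralizedHexagon 4 H)
    {r v w p₁ p₂ p₃ p₄ p₅ q₁ q₂ q₃ q₄ q₅ : V}
    (p : HexPath H v p₁ p₂ p₃ p₄ p₅ w) (q : HexPath H v q₁ q₂ q₃ q₄ q₅ w)
    (h5 : H.dist r w ≤ 5) (hp : H.dist r p₅ < H.dist r w) (hq : H.dist r q₅ < H.dist r w) :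
    p₁ = q₁ :=
  p.eq_of_penultimate_eq h q (h.uniqueLower r w p₅ q₅ h5 p.a₅.symm q.a₅.symm hp hq)

/-- The path climbs without a turn until level 6. Afterwards it could fall to level 3 before its end
only by entering the last vertex from below, since that vertex is not lower than the first; `hc`
excludes this. For `l₀ = 1` the climb ends too late for the case to arise. -/
theorem hexPath_level_bounds {l₀ l₁ l₂ l₃ l₄ l₅ l₆ : ℕ} (h1 : 1 ≤ l₀) (h06 : l₀ ≤ l₆)
    (h01 : l₁ = l₀ + 1)
    (h : (l₀ ≤ 6 ∧ l₁ ≤ 6 ∧ l₂ ≤ 6 ∧ l₃ ≤ 6 ∧ l₄ ≤ 6 ∧ l₅ ≤ 6 ∧ l₆ ≤ 6) ∧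
      ((l₁ = l₀ + 1 ∨ l₀ = l₁ + 1) ∧ (l₂ = l₁ + 1 ∨ l₁ = l₂ + 1) ∧ (l₃ = l₂ + 1 ∨ l₂ = l₃ + 1) ∧
      (l₄ = l₃ + 1 ∨ l₃ = l₄ + 1) ∧ (l₅ = l₄ + 1 ∨ l₄ = l₅ + 1) ∧ (l₆ = l₅ + 1 ∨ l₅ = l₆ + 1)) ∧
      (¬ (l₁ ≤ 5 ∧ l₀ < l₁ ∧ l₂ < l₁) ∧ ¬ (l₂ ≤ 5 ∧ l₁ < l₂ ∧ l₃ < l₂) ∧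
      ¬ (l₃ ≤ 5 ∧ l₂ < l₃ ∧ l₄ < l₃) ∧ ¬ (l₄ ≤ 5 ∧ l₃ < l₄ ∧ l₅ < l₄) ∧
      ¬ (l₅ ≤ 5 ∧ l₄ < l₅ ∧ l₆ < l₅)))
    (hc : l₀ ≠ 1 → l₆ ≤ 5 → l₆ ≤ l₅) :
    (l₁ = 3 → l₀ = 2) ∧ (l₂ = 3 → l₀ = 1) ∧ l₃ ≠ 3 ∧ l₄ ≠ 3 ∧ l₅ ≠ 3 := by
  obtain ⟨⟨b0, b1, b2, b3, b4, b5, b6⟩, ⟨-, d1, d2, d3, d4, d5⟩, e1, e2, e3, e4, e5⟩ := h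
  subst h01
  have b0' : l₀ ≤ 5 := by omega
  have hl : l₀ = 1 ∨ l₀ = 2 ∨ l₀ = 3 ∨ l₀ = 4 ∨ l₀ = 5 := by omega
  have step : ∀ {a b c : ℕ}, b ≤ 5 → a < b → (c = b + 1 ∨ b = c + 1) →
      ¬ (b ≤ 5 ∧ a < b ∧ c < b) → c = b + 1 := by omega
  have top : ∀ {c : ℕ}, c ≤ 6 → (c = 6 + 1 ∨ 6 = c + 1) → c = 5 := by omega
  rcases hl with rfl | rfl | rfl | rfl | rfl
  · obtain rfl := step (by norm_num) (by norm_num) d1 e1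
    obtain rfl := step (by norm_num) (by norm_num) d2 e2
    obtain rfl := step (by norm_num) (by norm_num) d3 e3
    omega
  · obtain rfl := step (by norm_num) (by norm_num) d1 e1
    obtain rfl := step (by norm_num) (by norm_num) d2 e2
    obtain rfl := step (by norm_num) (by norm_num) d3 e3
    obtain rfl := top b5 d4
    omega
  · obtain rfl := step (by norm_num) (by norm_num) d1 e1
    obtain rfl := step (by norm_num) (by norm_num) d2 e2
    obtain rfl := top b4 d3
    omega
  · obtain rfl := step (by norm_num) (by norm_num) d1 e1
    obtain rfl := top b3 d2
    omega
  · obtain rfl := top b2 d1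
    rcases d2 with rfl | d2
    · obtain rfl := top b4 d3
      omega
    · obtain rfl : l₃ = 4 := by omega
      clear d1 e1 e2 step top
      rcases d3 with rfl | d3
      · omega
      · obtain rfl : l₄ = 3 := by omega
        omega

section Avoiding

variable {V : Type*} {H : SimpleGraph V} {r g : V} {X : ZMod 8 → V}

theorem IsReplaceable.level (hX : IsReplaceable H r g X) {x : V} (hx : x ∈ Set.range X) :
    H.dist r x = 3 := by
  obtain ⟨t, rfl⟩ := hx
  exact hX.depth t

theorem IsReplaceable.sibling_eq (hX : IsReplaceable H r g X) {x y w : V} (hx : x ∈ Set.range X)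
    (hy : y ∈ Set.range X) (hw : H.dist r w = 2) (hwx : H.Adj w x) (hwy : H.Adj w y) : x = y := by
  obtain ⟨s, rfl⟩ := hx
  obtain ⟨t, rfl⟩ := hy
  rw [hX.sibling s t ⟨w, hw, hwx, hwy⟩]

/-- A path between the opposite vertices `v` and `w` has no interior vertex in `S`. -/
def HasAvoidingPath (H : SimpleGraph V) (S : Set V) (v w : V) : Prop :=
  ∃ p₁ p₂ p₃ p₄ p₅, HexPath H v p₁ p₂ p₃ p₄ p₅ w ∧ p₁ ∉ S ∧ p₂ ∉ S ∧ p₃ ∉ S ∧ p₄ ∉ S ∧ p₅ ∉ S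

theorem HasAvoidingPath.symm {S : Set V} {v w : V} (h : HasAvoidingPath H S v w) :
    HasAvoidingPath H S w v := by
  obtain ⟨p₁, p₂, p₃, p₄, p₅, p, h1, h2, h3, h4, h5⟩ := h
  exact ⟨p₅, p₄, p₃, p₂, p₁, p.symm, h5, h4, h3, h2, h1⟩

theorem hasAvoidingPath_of_level_zero (h : IsGeneralizedHexagon 4 H) (hX : IsReplaceable H r g X)
    {w : V} (hw : H.dist r w = 6) : HasAvoidingPath H (Set.range X) r w := by
  obtain ⟨p₂, p₃, p₄, p₅, p⟩ := h.exists_hexPath hw hX.free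
  have hl := p.levels h r H.dist_self rfl rfl rfl rfl rfl hw
  have hg1 : H.dist r g = 1 := SimpleGraph.dist_eq_one_iff_adj.2 hX.free
  refine ⟨_, _, _, _, _, p, ?_, ?_, ?_, ?_, ?_⟩ <;> intro hp
  · have := hX.level hp; omega
  · have := hX.level hp; omega
  · have h3 := hX.level hp
    obtain ⟨t, rfl⟩ := hp
    apply hX.free_branch t
    have d1 := SimpleGraph.dist_eq_one_iff_adj.2 p.a₁
    have d2 := p.a₂.diff_dist_adj (u := g)
    have d3 := hX.free.diff_dist_adj (u := X t)
    simp only [SimpleGraph.dist_comm (u := X t)] at d3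
    omega
  · have := hX.level hp; omega
  · have := hX.level hp; omega

theorem hasAvoidingPath_of_level_six (h : IsGeneralizedHexagon 4 H) (hX : IsReplaceable H r g X)
    {v w : V} (hv : H.dist r v = 6) (hw : H.dist r w = 6) (hvw : H.dist v w = 6) :
    HasAvoidingPath H (Set.range X) v w := by
  have hbr : ∀ y, H.dist r y ≤ H.dist g y + 1 := fun y => by
    have := hX.free.diff_dist_adj (u := y)
    simp only [SimpleGraph.dist_comm (u := y)] at this
    omega
  have hgv : H.dist g v = 4 + 1 := by
    have := h.level_cases v hX.free
    simp only [SimpleGraph.dist_comm (u := v)] at this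
    omega
  obtain ⟨u, hu, hgu⟩ := exists_lower hgv
  obtain ⟨p₂, p₃, p₄, p₅, p⟩ := h.exists_hexPath hvw hu
  have hl := p.levels h r hv rfl rfl rfl rfl rfl hw
  refine ⟨_, _, _, _, _, p, ?_, ?_, ?_, ?_, ?_⟩ <;> intro hp
  · have := hX.level hp; omega
  · have := hX.level hp; omega
  · have h3 := hX.level hp
    obtain ⟨t, rfl⟩ := hp
    obtain ⟨y, hy, hgy⟩ := exists_lower (n := 3) hgu
    have hb := hbr y
    -- A path that reaches level 3 has come straight down, so uniqueness of lower neighbours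
    -- identifies it with the geodesic towards `g`; it therefore stays in the free branch.
    obtain rfl : y = p₂ := h.uniqueLower r u y p₂ (by omega) hy p.a₁ (by omega) (by omega)
    obtain ⟨z, hz, hgz⟩ := exists_lower (n := 2) hgy
    have hb' := hbr z
    obtain rfl : z = X t := h.uniqueLower r y z _ (by omega) hz p.a₂ (by omega) (by omega)
    exact hX.free_branch t hgz
  · have := hX.level hp; omega
  · have := hX.level hp; omega

/-- The obstruction to the path through the child `u` of `v` if it meets a replaced vertex. -/
theorem HexPath.obstruction (h : IsGeneralizedHexagon 4 H) (hX : IsReplaceable H r g X)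
    {v w u p₂ p₃ p₄ p₅ : V} (p : HexPath H v u p₂ p₃ p₄ p₅ w) (h1 : 1 ≤ H.dist r v)
    (hvw : H.dist r v ≤ H.dist r w) (hu : H.dist r u = H.dist r v + 1)
    (hbad : ¬ HasAvoidingPath H (Set.range X) v w) :
    (H.dist r v ≠ 1 ∧ H.dist r w ≤ 5 ∧ H.dist r p₅ < H.dist r w) ∨
      (H.dist r v = 2 ∧ u ∈ Set.range X) ∨ (H.dist r v = 1 ∧ ∃ t, H.Adj u (X t)) := by
  have hl := p.levels h r rfl rfl rfl rfl rfl rfl rfl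
  have h₂ := fun hp => hX.level (x := p₂) hp
  have h₃ := fun hp => hX.level (x := p₃) hp
  have h₄ := fun hp => hX.level (x := p₄) hp
  have h₅ := fun hp => hX.level (x := p₅) hp
  by_contra hcon
  push Not at hcon
  obtain ⟨c1, c2, c3⟩ := hcon
  have c3' : H.dist r v = 1 → p₂ ∉ Set.range X := by
    rintro hv ⟨t, rfl⟩
    exact c3 hv t p.a₁
  have h₁ := fun hp => hX.level (x := u) hp
  obtain ⟨k1, k2, k3, k4, k5⟩ := hexPath_level_bounds h1 hvw hu hl c1
  exact hbad ⟨_, _, _, _, _, p, fun hp => c2 (k1 (h₁ hp)) hp, fun hp => c3' (k2 (h₂ hp)) hp,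
    fun hp => k3 (h₃ hp), fun hp => k4 (h₄ hp), fun hp => k5 (h₅ hp)⟩

/-- Pigeonhole over the four children of `v`. Entering `w` from below spoils at most one child, and
being itself replaced spoils at most one. At level 1 the only obstruction is a replaced child of the
child, which spoils at most two since a branch has two replaced vertices. -/
theorem hasAvoidingPath_of_level_between (h : IsGeneralizedHexagon 4 H)
    (hX : IsReplaceable H r g X) {v w : V} (h1 : 1 ≤ H.dist r v) (h5 : H.dist r v ≤ 5)
    (hle : H.dist r v ≤ H.dist r w) (hvw : H.dist v w = 6) :
    HasAvoidingPath H (Set.range X) v w := by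
  obtain ⟨u, hu, hur⟩ := exists_injective_range_eq (h.ncard_children h1 h5) (by norm_num)
  have huc : ∀ i, H.Adj v (u i) ∧ H.dist r (u i) = H.dist r v + 1 := fun i => by
    have : u i ∈ children H r v := hur ▸ Set.mem_range_self i
    exact this
  by_contra hbad
  have hex := fun i => h.exists_hexPath hvw (huc i).1
  choose p₂ p₃ p₄ p₅ p using hex
  have hob := fun i => (p i).obstruction h hX h1 hle (huc i).2 hbad
  have hne : ∀ i j, i ≠ j → u i ≠ u j := fun i j hij he => hij (hu he)
  have hA : ∀ i j, i ≠ j → (H.dist r v ≠ 1 ∧ H.dist r w ≤ 5 ∧ H.dist r (p₅ i) < H.dist r w) →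
      ¬ (H.dist r v ≠ 1 ∧ H.dist r w ≤ 5 ∧ H.dist r (p₅ j) < H.dist r w) :=
    fun i j hij hi hj => hne i j hij ((p i).eq_of_lower h (p j) hi.2.1 hi.2.2 hj.2.2)
  have hB : ∀ i j, i ≠ j → (H.dist r v = 2 ∧ u i ∈ Set.range X) →
      ¬ (H.dist r v = 2 ∧ u j ∈ Set.range X) :=
    fun i j hij hi hj => hne i j hij (hX.sibling_eq hi.2 hj.2 hi.1 (huc i).1 (huc j).1)
  by_cases hv1 : H.dist r v = 1
  · have hC : ∀ i, ∃ t, H.Adj (u i) (X t) := fun i => by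
      rcases hob i with h' | h' | h'
      · exact absurd hv1 h'.1
      · omega
      · exact h'.2
    choose t ht using hC
    have hd : ∀ i, H.dist v (X (t i)) = 2 := fun i => by
      have e1 := SimpleGraph.dist_eq_one_iff_adj.2 (huc i).1
      have e2 := (ht i).diff_dist_adj (u := v)
      have e3 := hX.depth (t i)
      have e4 := (SimpleGraph.dist_eq_one_iff_adj.1 hv1).diff_dist_adj (u := X (t i))
      simp only [SimpleGraph.dist_comm (u := X (t i))] at e4
      omega
    have hij : ∀ i j, i ≠ j → t i = t j + 4 := fun i j hij => by
      refine (hX.cousin (t i) (t j)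
        ⟨v, SimpleGraph.dist_eq_one_iff_adj.1 hv1, hd i, hd j⟩).resolve_left fun he => ?_
      refine hne i j hij (h.uniqueLower r (X (t i)) _ _ (by rw [hX.depth]; norm_num) (ht i).symm
        (he ▸ (ht j).symm) ?_ ?_)
      · rw [hX.depth, (huc i).2]; omega
      · rw [hX.depth, (huc j).2]; omega
    have h01 := hij 0 1 (by decide)
    have h12 := hij 1 2 (by decide)
    have h02 := hij 0 2 (by decide)
    -- Three indices cannot pairwise differ by 4.
    have h12' : t 1 = t 2 := add_right_cancel (h01.symm.trans h02)
    rw [h12', left_eq_add] at h12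
    exact absurd h12 (by decide)
  · have hob' := fun i => (hob i).imp_right fun h' => h'.resolve_right fun h'' => hv1 h''.1
    rcases hob' 0 with h0 | h0 <;> rcases hob' 1 with h1 | h1 <;> rcases hob' 2 with h2 | h2
    · exact hA 0 1 (by decide) h0 h1
    · exact hA 0 1 (by decide) h0 h1
    · exact hA 0 2 (by decide) h0 h2
    · exact hB 1 2 (by decide) h1 h2
    · exact hA 1 2 (by decide) h1 h2
    · exact hB 0 2 (by decide) h0 h2
    · exact hB 0 1 (by decide) h0 h1
    · exact hB 0 1 (by decide) h0 h1

theorem exists_avoiding_path (h : IsGeneralizedHexagon 4 H) (hX : IsReplaceable H r g X) {v w : V}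
    (hvw : H.dist v w = 6) : HasAvoidingPath H (Set.range X) v w := by
  wlog hle : H.dist r v ≤ H.dist r w generalizing v w
  · exact (this (by rw [SimpleGraph.dist_comm, hvw]) (by omega)).symm
  have hdist := dist_le_of_ediam_le h.diameter.le r
  by_cases h0 : H.dist r v = 0
  · obtain rfl : r = v := h.connected.dist_eq_zero_iff.1 h0
    exact hasAvoidingPath_of_level_zero h hX hvw
  by_cases h6 : H.dist r v = 6
  · exact hasAvoidingPath_of_level_six h hX h6 (by have := hdist w; omega) hvw
  · exact hasAvoidingPath_of_level_between h hX (by omega) (by have := hdist v; omega) hle hvw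

end Avoiding

/-! ### The substituted graph -/

/-- The new edges between the complete graphs: they contract to the Wagner graph, a cubic graph of
diameter `2` on `8` vertices. -/
def WagnerLink (s : ZMod 8) (a : Fin 4) (t : ZMod 8) (b : Fin 4) : Prop :=
  (t = s + 4 ∧ a = 1 ∧ b = 1) ∨ (t = s + 1 ∧ a = 2 ∧ b = 3) ∨ (s = t + 1 ∧ a = 3 ∧ b = 2)

instance (s : ZMod 8) (a : Fin 4) (t : ZMod 8) (b : Fin 4) : Decidable (WagnerLink s a t b) :=
  inferInstanceAs (Decidable (_ ∨ _))

theorem add_four_add_four (s : ZMod 8) : s + 4 + 4 = s := by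
  rw [add_assoc, show (4 : ZMod 8) + 4 = 0 by decide, add_zero]

theorem WagnerLink.symm {s t : ZMod 8} {a b : Fin 4} (h : WagnerLink s a t b) :
    WagnerLink t b s a := by
  rcases h with ⟨rfl, rfl, rfl⟩ | ⟨rfl, rfl, rfl⟩ | ⟨rfl, rfl, rfl⟩
  · exact Or.inl ⟨(add_four_add_four s).symm, rfl, rfl⟩
  · exact Or.inr (Or.inr ⟨rfl, rfl, rfl⟩)
  · exact Or.inr (Or.inl ⟨rfl, rfl, rfl⟩)

theorem WagnerLink.ne {s t : ZMod 8} {a b : Fin 4} (h : WagnerLink s a t b) : s ≠ t := by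
  have h4 : (4 : ZMod 8) ≠ 0 := by decide
  have h1 : (1 : ZMod 8) ≠ 0 := by decide
  rcases h with ⟨rfl, -⟩ | ⟨rfl, -⟩ | ⟨rfl, -⟩ <;> simp [h4, h1]

/-- Slot 1 carries the antipodal chord, slots 2 and 3 the two directions of the 8-cycle. One link
per slot keeps the degree at 5. -/
theorem WagnerLink.unique {s t t' : ZMod 8} {a b b' : Fin 4} (h : WagnerLink s a t b)
    (h' : WagnerLink s a t' b') : t = t' ∧ b = b' := by
  rcases h with ⟨rfl, rfl, rfl⟩ | ⟨rfl, rfl, rfl⟩ | ⟨rfl, rfl, rfl⟩ <;>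
    simp [WagnerLink] at h' <;> simp [h']

/-- Slot 0 is reserved for the edge to the parent. -/
theorem not_wagnerLink_zero {s t : ZMod 8} {b : Fin 4} : ¬ WagnerLink s 0 t b := by
  simp [WagnerLink]

theorem exists_wagnerLink (s t : ZMod 8) : s = t ∨ (∃ a b, WagnerLink s a t b) ∨
    ∃ m, (∃ a b, WagnerLink s a m b) ∧ ∃ a b, WagnerLink m a t b := by
  have key : ∀ s t : ZMod 8, s = t ∨ (t = s + 4 ∨ t = s + 1 ∨ s = t + 1) ∨
      ∃ m, (m = s + 4 ∨ m = s + 1 ∨ s = m + 1) ∧ (t = m + 4 ∨ t = m + 1 ∨ m = t + 1) := by decide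
  have hl : ∀ s t : ZMod 8, (t = s + 4 ∨ t = s + 1 ∨ s = t + 1) → ∃ a b, WagnerLink s a t b := by
    rintro s t (h | h | h)
    · exact ⟨1, 1, Or.inl ⟨h, rfl, rfl⟩⟩
    · exact ⟨2, 3, Or.inr (Or.inl ⟨h, rfl, rfl⟩)⟩
    · exact ⟨3, 2, Or.inr (Or.inr ⟨h, rfl, rfl⟩)⟩
  rcases key s t with h | h | ⟨m, h, h'⟩
  · exact Or.inl h
  · exact Or.inr (Or.inl (hl s t h))
  · exact Or.inr (Or.inr ⟨m, hl s m h, hl m t h'⟩)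

section Substitution

variable {V : Type*}

/-- Adjacency after the substitution, where `σ x u` is the vertex of `K_x` that the former
neighbour `u` of `x` is joined to. -/
def substAdj (H : SimpleGraph V) (X : ZMod 8 → V) (σ : V → V → Fin 4) :
    {v : V // v ∉ Set.range X} ⊕ Set.range X × Fin 4 →
      {v : V // v ∉ Set.range X} ⊕ Set.range X × Fin 4 → Prop
  | .inl u, .inl v => H.Adj u v
  | .inl u, .inr (x, a) => H.Adj u x ∧ σ x u = a
  | .inr (x, a), .inl u => H.Adj u x ∧ σ x u = a
  | .inr (x, a), .inr (y, b) => (x = y ∧ a ≠ b) ∨ ∃ s t, X s = x ∧ X t = y ∧ WagnerLink s a t b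

/-- The graph obtained from `H` by substituting complete graphs for the vertices `X t`. -/
def substGraph (H : SimpleGraph V) {X : ZMod 8 → V} (hX : Function.Injective X)
    (σ : V → V → Fin 4) : SimpleGraph ({v : V // v ∉ Set.range X} ⊕ Set.range X × Fin 4) where
  Adj := substAdj H X σ
  symm := ⟨by
    rintro (u | ⟨x, a⟩) (v | ⟨y, b⟩) h
    · exact SimpleGraph.Adj.symm (G := H) h
    · exact h
    · exact h
    · rcases h with ⟨rfl, h⟩ | ⟨s, t, hs, ht, h⟩
      · exact Or.inl ⟨rfl, h.symm⟩
      · exact Or.inr ⟨t, s, ht, hs, h.symm⟩⟩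
  loopless := ⟨by
    rintro (u | ⟨x, a⟩) h
    · exact H.loopless.irrefl _ h
    · rcases h with ⟨-, h⟩ | ⟨s, t, hs, ht, h⟩
      · exact h rfl
      · exact h.ne (hX (hs.trans ht.symm))⟩

/-- `σ x` numbers the four children of `x` and is `0` at the parent of `x`. -/
structure IsSlot (H : SimpleGraph V) (r : V) (X : ZMod 8 → V) (σ : V → V → Fin 4) : Prop where
  inj : ∀ x ∈ Set.range X, ∀ u ∈ children H r x, ∀ u' ∈ children H r x, σ x u = σ x u' → u = u'
  surj : ∀ x ∈ Set.range X, ∀ a, ∃ u ∈ children H r x, σ x u = a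
  parent : ∀ x ∈ Set.range X, ∀ u, u ∉ children H r x → σ x u = 0

variable {H : SimpleGraph V} {r g : V} {X : ZMod 8 → V} {σ : V → V → Fin 4}

theorem IsGeneralizedHexagon.exists_isSlot (h : IsGeneralizedHexagon 4 H)
    (hX : IsReplaceable H r g X) : ∃ σ, IsSlot H r X σ := by
  classical
  have : ∀ x, ∃ f : V → Fin 4, x ∈ Set.range X →
      (∀ u ∈ children H r x, ∀ u' ∈ children H r x, f u = f u' → u = u') ∧
      (∀ a, ∃ u ∈ children H r x, f u = a) ∧ ∀ u, u ∉ children H r x → f u = 0 := by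
    intro x
    by_cases hx : x ∈ Set.range X
    · have h3 := hX.level hx
      have hc := h.ncard_children (r := r) (v := x) (by omega) (by omega)
      have hfin : (children H r x).Finite := Set.finite_of_ncard_ne_zero (by omega)
      have := hfin.to_subtype
      have e : children H r x ≃ Fin 4 := Finite.equivFinOfCardEq hc
      refine ⟨fun u => if hu : u ∈ children H r x then e ⟨u, hu⟩ else 0, fun _ => ⟨?_, ?_, ?_⟩⟩
      · intro u hu u' hu' he
        simp only [hu, hu', dif_pos] at he
        exact congrArg Subtype.val (e.injective he)
      · intro a
        exact ⟨e.symm a, (e.symm a).2, by simp⟩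
      · intro u hu
        simp [hu]
    · exact ⟨fun _ => 0, fun hx' => absurd hx' hx⟩
  choose σ hσ using this
  exact ⟨σ, fun x hx => (hσ x hx).1, fun x hx => (hσ x hx).2.1, fun x hx => (hσ x hx).2.2⟩

theorem IsReplaceable.notMem_of_adj (h : IsGeneralizedHexagon 4 H) (hX : IsReplaceable H r g X)
    {x u : V} (hx : x ∈ Set.range X) (hu : H.Adj x u) : u ∉ Set.range X := by
  intro hu'
  have h1 := hX.level hx
  have h2 := hX.level hu'
  have h3 := h.level_cases r hu
  omega

theorem isSubstitution_substGraph (h : IsGeneralizedHexagon 4 H) (hX : IsReplaceable H r g X)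
    (hσ : IsSlot H r X σ) :
    IsSubstitution H r (Set.range X) 4 (substGraph H hX.injective σ) where
  depth x hx := hX.level hx
  old u v := Iff.rfl
  complete x a b := by
    refine ⟨?_, fun hab => Or.inl ⟨rfl, hab⟩⟩
    rintro (⟨-, hab⟩ | ⟨s, t, hs, ht, hl⟩)
    · exact hab
    · exact absurd (hX.injective (hs.trans ht.symm)) hl.ne
  attached u x a hu := hu.1
  reattach u x hu := ⟨σ x u, ⟨hu, rfl⟩, fun b hb => hb.2.symm⟩
  outward x a := by
    obtain ⟨u, hu, ha⟩ := hσ.surj x x.2 a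
    refine ⟨⟨u, hX.notMem_of_adj h x.2 hu.1⟩, ?_, hu.1.symm, ha⟩
    rw [hu.2, hX.level x.2]
  siblings := by
    rintro ⟨_, s, rfl⟩ ⟨_, t, rfl⟩ hne hp
    exact absurd (Subtype.ext (congrArg X (hX.sibling s t hp))) hne
  cousins := by
    rintro ⟨_, s, rfl⟩ ⟨_, t, rfl⟩ hg hp
    obtain ⟨w, hw, hd⟩ := exists_lower (n := 2) (hX.depth t)
    have hst : s = t + 4 := (hX.cousin s t hg).resolve_left fun he =>
      hp ⟨w, hd, he ▸ hw.symm, hw.symm⟩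
    -- The antipodal chord of the Wagner graph is the edge required between cousins.
    refine ⟨⟨X t, t, rfl⟩, ⟨w, hd, hw.symm, hw.symm⟩, 1, 1, Or.inr ⟨s, t, rfl, rfl, Or.inl ?_⟩⟩
    exact ⟨by rw [hst, add_four_add_four], rfl, rfl⟩

/-! ### Order and degrees -/

theorem card_substGraph (h : IsGeneralizedHexagon 4 H) (hX : Function.Injective X) :
    Nat.card ({v : V // v ∉ Set.range X} ⊕ Set.range X × Fin 4) = 2754 := by
  have := IsBipartiteMoore.finite (by norm_num) h
  have h8 : (Set.range X).ncard = 8 := by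
    rw [← Set.image_univ, Set.ncard_image_of_injective _ hX, Set.ncard_univ, Nat.card_zmod]
  -- `2730 - 8 = 2722`, and the eight cliques add 32.
  have hc : Nat.card {v : V // v ∉ Set.range X} = 2722 := by
    have h1 := Set.ncard_add_ncard_compl (Set.range X)
    have h2 := h.order
    norm_num [Finset.sum_range_succ] at h2
    have h3 : Nat.card {v : V // v ∉ Set.range X} = (Set.range X)ᶜ.ncard := rfl
    omega
  have hs : Nat.card (Set.range X) = 8 := h8
  rw [Nat.card_sum, Nat.card_prod, hc, hs, Nat.card_fin]

/-- Contracting the cliques maps the new neighbours bijectively onto the old ones, since `u` is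
attached to a single vertex of each adjacent clique. -/
theorem ncard_neighborSet_inl (h : IsGeneralizedHexagon 4 H) (hX : Function.Injective X)
    (u : {v : V // v ∉ Set.range X}) :
    ((substGraph H hX σ).neighborSet (Sum.inl u)).ncard = 5 := by
  let f : {v : V // v ∉ Set.range X} ⊕ Set.range X × Fin 4 → V :=
    Sum.elim Subtype.val fun p => p.1
  have himg : f '' (substGraph H hX σ).neighborSet (Sum.inl u) = H.neighborSet u := by
    ext v
    constructor
    · rintro ⟨w | ⟨x, a⟩, hw, rfl⟩
      · exact hw
      · exact hw.1
    · intro hv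
      by_cases hvS : v ∈ Set.range X
      · exact ⟨Sum.inr (⟨v, hvS⟩, σ v u), ⟨hv, rfl⟩, rfl⟩
      · exact ⟨Sum.inl ⟨v, hvS⟩, hv, rfl⟩
  rw [← Set.InjOn.ncard_image (f := f), himg, h.regular]
  rintro (v | ⟨x, a⟩) hv (w | ⟨y, b⟩) hw hvw
  · exact congrArg Sum.inl (Subtype.ext hvw)
  · exact absurd (show (v : V) ∈ Set.range X from (show (v : V) = y from hvw) ▸ y.2) v.2
  · exact absurd (show (w : V) ∈ Set.range X from (show (x : V) = w from hvw) ▸ x.2) w.2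
  · obtain rfl : x = y := Subtype.ext hvw
    obtain rfl : a = b := hv.2.symm.trans hw.2
    rfl

theorem ncard_neighborSet_inr_le (h : IsGeneralizedHexagon 4 H) (hX : IsReplaceable H r g X)
    (hσ : IsSlot H r X σ) (x : Set.range X) (a : Fin 4) :
    ((substGraph H hX.injective σ).neighborSet (Sum.inr (x, a))).ncard ≤ 5 := by
  classical
  have := IsBipartiteMoore.finite (by norm_num) h
  have hlev := hX.level x.2
  obtain ⟨u, hu, hua⟩ := hσ.surj x x.2 a
  have huS := hX.notMem_of_adj h x.2 hu.1
  obtain ⟨w, hw, hwd⟩ := exists_lower (n := 2) hlev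
  have hwS := hX.notMem_of_adj h x.2 hw
  have huv : ∀ v, H.Adj v x → σ x v = a → v ∉ children H r x ∨ v = u := fun v hv hva => by
    by_cases hc : v ∈ children H r x
    · exact Or.inr (hσ.inj x x.2 v hc u hu (hva.trans hua.symm))
    · exact Or.inl hc
  have hpar : ∀ v, H.Adj v x → v ∉ children H r x → v = w := fun v hv hc => by
    refine h.uniqueLower r x v w (by omega) hv.symm hw ?_ (by omega)
    have := (h.level_cases r hv.symm).2.2
    simp only [children, Set.mem_ofPred_eq, not_and] at hc
    have := hc hv.symm
    omega
  let A : Finset ({v : V // v ∉ Set.range X} ⊕ Set.range X × Fin 4) :=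
    (Finset.univ.erase a).image fun b => Sum.inr (x, b)
  have hA : A.card ≤ 3 := Finset.card_image_le.trans (by simp)
  -- Besides three clique vertices and one child there is room for one more neighbour `y`: the
  -- parent in slot 0, the Wagner link elsewhere.
  have key : ∃ y, (substGraph H hX.injective σ).neighborSet (Sum.inr (x, a)) ⊆
      ↑(A ∪ {Sum.inl ⟨u, huS⟩, y}) := by
    by_cases ha : a = 0
    · refine ⟨Sum.inl ⟨w, hwS⟩, ?_⟩
      rintro (v | ⟨z, b⟩) hv
      · rcases huv v hv.1 hv.2 with hc | hc
        · have := hpar v hv.1 hc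
          simp [← this]
        · simp [← hc]
      · rcases hv with ⟨rfl, hab⟩ | ⟨s, t, hs, ht, hl⟩
        · simp [A, Ne.symm hab]
        · rw [ha] at hl
          exact absurd hl not_wagnerLink_zero
    · by_cases hl : ∃ s t b, X s = x ∧ WagnerLink s a t b
      · obtain ⟨s, t, b, hs, hl⟩ := hl
        refine ⟨Sum.inr (⟨X t, t, rfl⟩, b), ?_⟩
        rintro (v | ⟨z, b'⟩) hv
        · rcases huv v hv.1 hv.2 with hc | hc
          · exact absurd (hv.2.symm.trans (hσ.parent x x.2 v hc)) ha
          · simp [← hc]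
        · rcases hv with ⟨rfl, hab⟩ | ⟨s', t', hs', ht', hl'⟩
          · simp [A, Ne.symm hab]
          · obtain rfl := hX.injective (hs.trans hs'.symm)
            obtain ⟨rfl, rfl⟩ := hl.unique hl'
            have : z = ⟨X t, t, rfl⟩ := Subtype.ext ht'.symm
            simp [this]
      · refine ⟨Sum.inl ⟨u, huS⟩, ?_⟩
        rintro (v | ⟨z, b'⟩) hv
        · rcases huv v hv.1 hv.2 with hc | hc
          · exact absurd (hv.2.symm.trans (hσ.parent x x.2 v hc)) ha
          · simp [← hc]
        · rcases hv with ⟨rfl, hab⟩ | ⟨s', t', hs', ht', hl'⟩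
          · simp [A, Ne.symm hab]
          · exact absurd ⟨s', t', b', hs', hl'⟩ hl
  obtain ⟨y, hy⟩ := key
  refine (Set.ncard_le_ncard hy (Finset.finite_toSet _)).trans ?_
  rw [Set.ncard_coe_finset]
  exact (Finset.card_union_le _ _).trans (by
    have := Finset.card_le_two (a := (Sum.inl ⟨u, huS⟩ :
      {v : V // v ∉ Set.range X} ⊕ Set.range X × Fin 4)) (b := y)
    omega)

theorem ncard_neighborSet_substGraph_le (h : IsGeneralizedHexagon 4 H)
    (hX : IsReplaceable H r g X) (hσ : IsSlot H r X σ)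
    (v : {v : V // v ∉ Set.range X} ⊕ Set.range X × Fin 4) :
    ((substGraph H hX.injective σ).neighborSet v).ncard ≤ 5 := by
  rcases v with u | ⟨x, a⟩
  · exact (ncard_neighborSet_inl h hX.injective u).le
  · exact ncard_neighborSet_inr_le h hX hσ x a

end Substitution

/-! ### Diameter of the substituted graph -/

/-- The distance from `a` to `b` in `G` is at most `n`. -/
def Near {V : Type*} (G : SimpleGraph V) (n : ℕ) (a b : V) : Prop := G.edist a b ≤ n

namespace Near

variable {V : Type*} {G : SimpleGraph V} {m n : ℕ} {a b c : V}

theorem refl (a : V) : Near G 0 a a := by simp [Near]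

theorem of_adj (h : G.Adj a b) : Near G 1 a b := by
  simp [Near, SimpleGraph.edist_eq_one_iff_adj.2 h]

theorem symm (h : Near G n a b) : Near G n b a := by
  rwa [Near, SimpleGraph.edist_comm]

theorem trans (h : Near G m a b) (h' : Near G n b c) : Near G (m + n) a c := by
  refine (SimpleGraph.edist_triangle (v := b)).trans ?_
  push_cast
  exact add_le_add h h'

theorem mono (h : Near G m a b) (hmn : m ≤ n) : Near G n a b :=
  le_trans h (by exact_mod_cast hmn)

theorem cons (h : G.Adj a b) (h' : Near G n b c) : Near G (n + 1) a c :=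
  ((of_adj h).trans h').mono (by omega)

theorem of_dist_le (hG : G.Connected) (h : G.dist a b ≤ n) : Near G n a b := by
  rw [Near, ← (hG a b).coe_dist_eq_edist]
  exact_mod_cast h

end Near

section Distance

variable {V : Type*} {H : SimpleGraph V} {r g : V} {X : ZMod 8 → V} {σ : V → V → Fin 4}

theorem near_complete (hX : Function.Injective X) (x : Set.range X) (a b : Fin 4) :
    Near (substGraph H hX σ) 1 (Sum.inr (x, a)) (Sum.inr (x, b)) := by
  by_cases hab : a = b
  · subst hab
    exact (Near.refl _).mono (by norm_num)
  · exact Near.of_adj (Or.inl ⟨rfl, hab⟩)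

theorem exists_near_of_wagnerLink (hX : Function.Injective X) {s t : ZMod 8}
    (hst : ∃ a b, WagnerLink s a t b) (a : Fin 4) :
    ∃ b, Near (substGraph H hX σ) 2 (Sum.inr (⟨X s, s, rfl⟩, a)) (Sum.inr (⟨X t, t, rfl⟩, b)) := by
  obtain ⟨a', b, hl⟩ := hst
  have ha : (substGraph H hX σ).Adj (Sum.inr (⟨X s, s, rfl⟩, a')) (Sum.inr (⟨X t, t, rfl⟩, b)) :=
    Or.inr ⟨s, t, rfl, rfl, hl⟩
  exact ⟨b, (near_complete hX _ a a').trans (Near.of_adj ha)⟩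

theorem near_replaced (hX : Function.Injective X) (x y : Set.range X) (a b : Fin 4) :
    Near (substGraph H hX σ) 5 (Sum.inr (x, a)) (Sum.inr (y, b)) := by
  obtain ⟨_, s, rfl⟩ := x
  obtain ⟨_, t, rfl⟩ := y
  rcases exists_wagnerLink s t with rfl | hl | ⟨m, hl, hl'⟩
  · exact (near_complete hX _ a b).mono (by norm_num)
  · obtain ⟨b', h1⟩ := exists_near_of_wagnerLink (H := H) (σ := σ) hX hl a
    exact (h1.trans (near_complete hX _ b' b)).mono (by norm_num)
  · obtain ⟨c, h1⟩ := exists_near_of_wagnerLink (H := H) (σ := σ) hX hl a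
    obtain ⟨b', h2⟩ := exists_near_of_wagnerLink (H := H) (σ := σ) hX hl' c
    exact ((h1.trans h2).trans (near_complete hX _ b' b)).mono (by norm_num)

/-- Distinct replaced vertices have distance at least `4`. -/
theorem IsReplaceable.four_le_dist (h : IsGeneralizedHexagon 4 H) (hX : IsReplaceable H r g X)
    {x y : V} (hx : x ∈ Set.range X) (hy : y ∈ Set.range X) (hne : x ≠ y) : 4 ≤ H.dist x y := by
  obtain ⟨c⟩ := h.coloring
  have hconn := h.connected
  have hxl := hX.level hx
  have hyl := hX.level hy
  have hev : Even (H.dist x y) := by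
    rw [even_dist_iff hconn c]
    have h1 := even_dist_iff hconn c r x
    have h2 := even_dist_iff hconn c r y
    rw [hxl] at h1
    rw [hyl] at h2
    have h3 : ¬ Even 3 := by decide
    simp only [h3, false_iff] at h1 h2
    revert h1 h2
    generalize c r = i
    generalize c x = j
    generalize c y = k
    revert i j k
    decide
  have h0 : H.dist x y ≠ 0 := fun h0 => hne (hconn.dist_eq_zero_iff.1 h0)
  by_contra hlt
  obtain ⟨k, hk⟩ := hev
  have h2 : H.dist x y = 1 + 1 := by omega
  obtain ⟨w, hwy, hxw⟩ := exists_adj_dist_of_dist_eq_succ h2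
  rw [SimpleGraph.dist_eq_one_iff_adj] at hxw
  have hl := h.level_cases r hxw
  -- A common neighbour is either a common parent or a vertex at level 4 with two parents.
  by_cases hw : H.dist r w = 2
  · exact hne (hX.sibling_eq hx hy hw hxw.symm hwy)
  · exact hne (h.uniqueLower r w x y (by omega) hxw.symm hwy (by omega) (by omega))

theorem substGraph_adj_inl_inr (hX : Function.Injective X) {u s : V} (hu : u ∉ Set.range X)
    (hs : s ∈ Set.range X) (hus : H.Adj u s) :
    (substGraph H hX σ).Adj (Sum.inl ⟨u, hu⟩) (Sum.inr (⟨s, hs⟩, σ s u)) :=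
  ⟨hus, rfl⟩

/-- A shortest path of `H` between two remaining vertices either survives the substitution, or it
passes through a replaced vertex `s`. -/
theorem near_or_exists_replaced (h : IsGeneralizedHexagon 4 H) (hX : Function.Injective X) (n : ℕ) :
    ∀ (v w : V) (hv : v ∉ Set.range X) (hw : w ∉ Set.range X), H.dist v w = n →
      Near (substGraph H hX σ) n (Sum.inl ⟨v, hv⟩) (Sum.inl ⟨w, hw⟩) ∨
      ∃ s ∈ Set.range X, ∃ (u : V) (hu : u ∉ Set.range X) (k : ℕ), H.Adj u s ∧ H.dist v u ≤ k ∧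
        Near (substGraph H hX σ) k (Sum.inl ⟨v, hv⟩) (Sum.inl ⟨u, hu⟩) ∧
        k + 1 + H.dist s w = n := by
  induction n with
  | zero =>
    intro v w hv hw hd
    obtain rfl := h.connected.dist_eq_zero_iff.1 hd
    exact Or.inl (Near.refl _)
  | succ n ih =>
    intro v w hv hw hd
    rw [SimpleGraph.dist_comm] at hd
    obtain ⟨v', hvv', hd'⟩ := exists_lower hd
    rw [SimpleGraph.dist_comm] at hd'
    by_cases hv' : v' ∈ Set.range X
    · exact Or.inr ⟨v', hv', v, hv, 0, hvv', by simp, Near.refl _, by omega⟩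
    · have ha : (substGraph H hX σ).Adj (Sum.inl ⟨v, hv⟩) (Sum.inl ⟨v', hv'⟩) := hvv'
      rcases ih v' w hv' hw hd' with hn | ⟨s, hs, u, hu, k, hus, hdu, hn, hk⟩
      · exact Or.inl (hn.cons ha)
      · refine Or.inr ⟨s, hs, u, hu, k + 1, hus, ?_, hn.cons ha, by omega⟩
        have := hvv'.diff_dist_adj (u := u)
        simp only [SimpleGraph.dist_comm (u := u)] at this
        omega

theorem exists_next (h : IsGeneralizedHexagon 4 H) (hX : IsReplaceable H r g X) {s w : V}
    (hs : s ∈ Set.range X) (hw : w ∉ Set.range X) :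
    ∃ (u : V), u ∉ Set.range X ∧ H.Adj u s ∧ H.dist u w + 1 = H.dist s w := by
  have h0 : H.dist s w ≠ 0 := fun h0 => hw (h.connected.dist_eq_zero_iff.1 h0 ▸ hs)
  obtain ⟨n, hn⟩ := Nat.exists_eq_succ_of_ne_zero h0
  have hn' := hn
  rw [SimpleGraph.dist_comm] at hn
  obtain ⟨u, hsu, hu⟩ := exists_lower hn
  exact ⟨u, hX.notMem_of_adj h hs hsu, hsu.symm, by rw [SimpleGraph.dist_comm, hu, hn']⟩

/-- One extra step inside `K_x` reaches the right exit. If the geodesic then meets another replaced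
`s`, the distance of at least 4 from `x` makes `s` adjacent to `w`, and 5 steps through the Wagner
graph followed by one edge suffice. -/
theorem near_replaced_remaining (h : IsGeneralizedHexagon 4 H) (hX : IsReplaceable H r g X)
    {x w : V} (hx : x ∈ Set.range X) (hw : w ∉ Set.range X) (hd : H.dist x w ≤ 5) (a : Fin 4) :
    Near (substGraph H hX.injective σ) 6 (Sum.inr (⟨x, hx⟩, a)) (Sum.inl ⟨w, hw⟩) := by
  obtain ⟨u, hu, hux, hud⟩ := exists_next h hX hx hw
  rcases near_or_exists_replaced (σ := σ) h hX.injective _ u w hu hw rfl with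
    hn | ⟨s, hs, u', hu', k, hus, hdu, hn, hk⟩
  · refine (((near_complete hX.injective _ a (σ x u)).trans (Near.of_adj
      (substGraph_adj_inl_inr hX.injective hu hx hux).symm)).trans hn).mono (by omega)
  · have hne : x ≠ s := by rintro rfl; omega
    have h4 := hX.four_le_dist h hx hs hne
    have h1 : H.dist x s ≤ k + 2 := by
      have e1 := h.connected.dist_triangle (u := x) (v := u) (w := s)
      have e2 := h.connected.dist_triangle (u := u) (v := u') (w := s)
      rw [SimpleGraph.dist_eq_one_iff_adj.2 hus] at e2
      rw [SimpleGraph.dist_eq_one_iff_adj.2 hux.symm] at e1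
      omega
    have h0 : H.dist s w ≠ 0 := fun h0 => hw (h.connected.dist_eq_zero_iff.1 h0 ▸ hs)
    have hsw : H.Adj s w := SimpleGraph.dist_eq_one_iff_adj.1 (by omega)
    exact (near_replaced hX.injective ⟨x, hx⟩ ⟨s, hs⟩ a (σ s w)).trans
      (Near.of_adj (substGraph_adj_inl_inr hX.injective hw hs hsw.symm).symm)

/-- No step inside `K_x` can be afforded, which is why every slot needs a child. The path through
that child has levels 3, 4, 5, 6, 5 and then 4 or 6, so its interior avoids level 3. -/
theorem near_replaced_opposite (h : IsGeneralizedHexagon 4 H) (hX : IsReplaceable H r g X)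
    (hσ : IsSlot H r X σ) {x w : V} (hx : x ∈ Set.range X) (hw : w ∉ Set.range X)
    (hd : H.dist x w = 6) (a : Fin 4) :
    Near (substGraph H hX.injective σ) 6 (Sum.inr (⟨x, hx⟩, a)) (Sum.inl ⟨w, hw⟩) := by
  obtain ⟨u, hu, rfl⟩ := hσ.surj x hx a
  have h3 := hX.level hx
  have hu4 : H.dist r u = 4 := by rw [hu.2, h3]
  obtain ⟨p₂, p₃, p₄, p₅, p⟩ := h.exists_hexPath hd hu.1
  have hl := p.levels h r h3 hu4 rfl rfl rfl rfl rfl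
  have h₂ : p₂ ∉ Set.range X := fun hp => by have := hX.level hp; omega
  have h₃ : p₃ ∉ Set.range X := fun hp => by have := hX.level hp; omega
  have h₄ : p₄ ∉ Set.range X := fun hp => by have := hX.level hp; omega
  have h₅ : p₅ ∉ Set.range X := fun hp => by have := hX.level hp; omega
  have h₁ := hX.notMem_of_adj h hx hu.1
  have c₀ := substGraph_adj_inl_inr (σ := σ) hX.injective h₁ hx hu.1.symm
  have c₁ : (substGraph H hX.injective σ).Adj (Sum.inl ⟨u, h₁⟩) (Sum.inl ⟨p₂, h₂⟩) := p.a₁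
  have c₂ : (substGraph H hX.injective σ).Adj (Sum.inl ⟨p₂, h₂⟩) (Sum.inl ⟨p₃, h₃⟩) := p.a₂
  have c₃ : (substGraph H hX.injective σ).Adj (Sum.inl ⟨p₃, h₃⟩) (Sum.inl ⟨p₄, h₄⟩) := p.a₃
  have c₄ : (substGraph H hX.injective σ).Adj (Sum.inl ⟨p₄, h₄⟩) (Sum.inl ⟨p₅, h₅⟩) := p.a₄
  have c₅ : (substGraph H hX.injective σ).Adj (Sum.inl ⟨p₅, h₅⟩) (Sum.inl ⟨w, hw⟩) := p.a₅
  exact (((((Near.of_adj c₅).cons c₄).cons c₃).cons c₂).cons c₁).cons c₀.symm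

/-- Crossing a clique costs one extra step, and a second crossing would need length at least `1 + 4
+ 1 = 6`. -/
theorem near_remaining (h : IsGeneralizedHexagon 4 H) (hX : IsReplaceable H r g X)
    {v w : V} (hv : v ∉ Set.range X) (hw : w ∉ Set.range X) (hd : H.dist v w ≤ 5) :
    Near (substGraph H hX.injective σ) 6 (Sum.inl ⟨v, hv⟩) (Sum.inl ⟨w, hw⟩) := by
  rcases near_or_exists_replaced (σ := σ) h hX.injective _ v w hv hw rfl with
    hn | ⟨s, hs, u, hu, k, hus, hdu, hn, hk⟩
  · exact hn.mono (by omega)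
  obtain ⟨u', hu', hus', hud'⟩ := exists_next h hX hs hw
  have hs' := (hn.trans (Near.of_adj (substGraph_adj_inl_inr hX.injective hu hs hus))).trans
    ((near_complete hX.injective ⟨s, hs⟩ (σ s u) (σ s u')).trans
      (Near.of_adj (substGraph_adj_inl_inr hX.injective hu' hs hus').symm))
  rcases near_or_exists_replaced (σ := σ) h hX.injective _ u' w hu' hw rfl with
    hn' | ⟨s', hs'', u'', hu'', k', hus'', hdu', hn', hk'⟩
  · exact (hs'.trans hn').mono (by omega)
  · exfalso
    have hne : s ≠ s' := by rintro rfl; omega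
    have h4 := hX.four_le_dist h hs hs'' hne
    have e1 := h.connected.dist_triangle (u := s) (v := u') (w := s')
    have e2 := h.connected.dist_triangle (u := u') (v := u'') (w := s')
    rw [SimpleGraph.dist_eq_one_iff_adj.2 hus''] at e2
    rw [SimpleGraph.dist_eq_one_iff_adj.2 hus'.symm] at e1
    have h0 : H.dist s' w ≠ 0 := fun h0 => hw (h.connected.dist_eq_zero_iff.1 h0 ▸ hs'')
    omega

theorem near_remaining_opposite (h : IsGeneralizedHexagon 4 H) (hX : IsReplaceable H r g X)
    {v w : V} (hv : v ∉ Set.range X) (hw : w ∉ Set.range X) (hd : H.dist v w = 6) :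
    Near (substGraph H hX.injective σ) 6 (Sum.inl ⟨v, hv⟩) (Sum.inl ⟨w, hw⟩) := by
  obtain ⟨p₁, p₂, p₃, p₄, p₅, p, h₁, h₂, h₃, h₄, h₅⟩ := exists_avoiding_path h hX hd
  have c₀ : (substGraph H hX.injective σ).Adj (Sum.inl ⟨v, hv⟩) (Sum.inl ⟨p₁, h₁⟩) := p.a₀
  have c₁ : (substGraph H hX.injective σ).Adj (Sum.inl ⟨p₁, h₁⟩) (Sum.inl ⟨p₂, h₂⟩) := p.a₁
  have c₂ : (substGraph H hX.injective σ).Adj (Sum.inl ⟨p₂, h₂⟩) (Sum.inl ⟨p₃, h₃⟩) := p.a₂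
  have c₃ : (substGraph H hX.injective σ).Adj (Sum.inl ⟨p₃, h₃⟩) (Sum.inl ⟨p₄, h₄⟩) := p.a₃
  have c₄ : (substGraph H hX.injective σ).Adj (Sum.inl ⟨p₄, h₄⟩) (Sum.inl ⟨p₅, h₅⟩) := p.a₄
  have c₅ : (substGraph H hX.injective σ).Adj (Sum.inl ⟨p₅, h₅⟩) (Sum.inl ⟨w, hw⟩) := p.a₅
  exact (((((Near.of_adj c₅).cons c₄).cons c₃).cons c₂).cons c₁).cons c₀

theorem near_six_substGraph (h : IsGeneralizedHexagon 4 H) (hX : IsReplaceable H r g X)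
    (hσ : IsSlot H r X σ) (v w : {v : V // v ∉ Set.range X} ⊕ Set.range X × Fin 4) :
    Near (substGraph H hX.injective σ) 6 v w := by
  have hle := dist_le_of_ediam_le h.diameter.le
  have mixed : ∀ x a w, Near (substGraph H hX.injective σ) 6 (Sum.inr (x, a)) (Sum.inl w) := by
    rintro ⟨x, hx⟩ a ⟨w, hw⟩
    rcases (hle x w).lt_or_eq with hd | hd
    · exact near_replaced_remaining h hX hx hw (by omega) a
    · exact near_replaced_opposite h hX hσ hx hw hd a
  rcases v with ⟨v, hv⟩ | ⟨x, a⟩ <;> rcases w with ⟨w, hw⟩ | ⟨y, b⟩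
  · rcases (hle v w).lt_or_eq with hd | hd
    · exact near_remaining h hX hv hw (by omega)
    · exact near_remaining_opposite h hX hv hw hd
  · exact (mixed y b _).symm
  · exact mixed x a _
  · exact (near_replaced hX.injective x y a b).mono (by norm_num)

theorem hasOrderDegreeDiameter_substGraph (h : IsGeneralizedHexagon 4 H)
    (hX : IsReplaceable H r g X) (hσ : IsSlot H r X σ) :
    HasOrderDegreeDiameter (substGraph H hX.injective σ) 2754 5 6 := by
  have := IsBipartiteMoore.finite (by norm_num) h
  have hr : r ∉ Set.range X := fun hr => by
    have := hX.level hr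
    simp at this
  have hdeg := ncard_neighborSet_substGraph_le h hX hσ
  have hcard := card_substGraph h hX.injective
  refine ⟨hcard, ⟨⟨Sum.inl ⟨r, hr⟩, ncard_neighborSet_inl h hX.injective _⟩, ?_⟩, ?_⟩
  · rintro _ ⟨v, rfl⟩
    exact hdeg v
  · exact ediam_eq_six (d := 4) (k := 5) (Sum.inl ⟨r, hr⟩) hdeg (hdeg _)
      (by rw [hcard]; norm_num) (near_six_substGraph h hX hσ)

end Distance

/-! ### Compounds -/

theorem Near.map {V W : Type*} {G : SimpleGraph V} {G' : SimpleGraph W} (φ : G →g G') {n : ℕ}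
    {a b : V} (h : Near G n a b) : Near G' n (φ a) (φ b) := by
  obtain ⟨p, hp⟩ := SimpleGraph.exists_walk_of_edist_ne_top
    (ne_top_of_le_ne_top (ENat.natCast_ne_top n) h)
  refine (SimpleGraph.edist_le (p.map φ)).trans ?_
  rw [SimpleGraph.Walk.length_map, hp]
  exact h

/-- The two colour classes of a regular bipartite graph have the same size. -/
theorem card_color_eq {W : Type*} [Finite W] {B : SimpleGraph W} {d : ℕ} (hd : d ≠ 0)
    (hreg : ∀ w, (B.neighborSet w).ncard = d) (c : B.Coloring Bool) :
    Nat.card {w // c w = true} = Nat.card {w // c w = false} := by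
  classical
  have := Fintype.ofFinite W
  have hcount : ∀ t : Bool, ∀ v, c v = t →
      (Finset.univ.filter fun w => c w = !t ∧ B.Adj v w).card = d := by
    intro t v hv
    rw [← hreg v, ← Set.ncard_coe_finset]
    congr 1
    ext w
    simp only [Finset.coe_filter, Finset.mem_univ, true_and, Set.mem_ofPred_eq,
      SimpleGraph.mem_neighborSet, and_iff_right_iff_imp]
    intro hvw
    have := c.valid hvw
    rw [hv] at this
    exact Bool.eq_not.2 this.symm
  have key := Finset.sum_card_bipartiteAbove_eq_sum_card_bipartiteBelow
    (s := Finset.univ.filter fun w => c w = true) (t := Finset.univ.filter fun w => c w = false) B.Adj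
  have hT : ∀ v ∈ Finset.univ.filter (fun w => c w = true), (Finset.bipartiteAbove B.Adj
      (Finset.univ.filter fun w => c w = false) v).card = d := by
    intro v hv
    rw [← hcount true v (Finset.mem_filter.1 hv).2]
    congr 1
    ext w
    simp [Finset.bipartiteAbove]
  have hF : ∀ w ∈ Finset.univ.filter (fun w => c w = false), (Finset.bipartiteBelow B.Adj
      (Finset.univ.filter fun w => c w = true) w).card = d := by
    intro w hw
    rw [← hcount false w (Finset.mem_filter.1 hw).2]
    congr 1
    ext v
    simp [Finset.bipartiteBelow, B.adj_comm]
  rw [Finset.sum_congr rfl hT, Finset.sum_congr rfl hF, Finset.sum_const, Finset.sum_const,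
    smul_eq_mul, smul_eq_mul] at key
  rw [Nat.card_eq_fintype_card, Nat.card_eq_fintype_card, Fintype.card_subtype,
    Fintype.card_subtype]
  exact Nat.eq_of_mul_eq_mul_right (Nat.pos_of_ne_zero hd) key

theorem card_color {W : Type*} [Finite W] {B : SimpleGraph W} {d n : ℕ} (hd : d ≠ 0)
    (hreg : ∀ w, (B.neighborSet w).ncard = d) (c : B.Coloring Bool) (hn : Nat.card W = 2 * n)
    (t : Bool) : Nat.card {w // c w = t} = n := by
  have h := card_color_eq hd hreg c
  have h1 : {w | c w = true}.ncard + {w | c w = true}ᶜ.ncard = 2 * n :=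
    hn ▸ Set.ncard_add_ncard_compl _
  have h2 : {w | c w = true}ᶜ = {w | c w = false} := by ext w; simp
  rw [h2] at h1
  have h3 : {w | c w = true}.ncard = Nat.card {w // c w = true} := rfl
  have h4 : {w | c w = false}.ncard = Nat.card {w // c w = false} := rfl
  cases t <;> omega

section Compound

variable {V W : Type*}

/-- Adjacency in a compound, where `f v t` is the vertex of colour `t` that `v` is joined to. -/
def compoundAdj (G : SimpleGraph V) (B : SimpleGraph W) (c : B.Coloring Bool) (f : V → Bool → W) :
    V ⊕ W → V ⊕ W → Prop
  | .inl u, .inl v => G.Adj u v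
  | .inl u, .inr w => f u (c w) = w
  | .inr w, .inl u => f u (c w) = w
  | .inr v, .inr w => B.Adj v w

/-- The compound of `G` and `B` in which `v` is joined to `f v false` and `f v true`. -/
def compoundGraph (G : SimpleGraph V) (B : SimpleGraph W) (c : B.Coloring Bool)
    (f : V → Bool → W) : SimpleGraph (V ⊕ W) where
  Adj := compoundAdj G B c f
  symm := ⟨by
    rintro (u | v) (u' | v') h
    · exact SimpleGraph.Adj.symm (G := G) h
    · exact h
    · exact h
    · exact SimpleGraph.Adj.symm (G := B) h⟩
  loopless := ⟨by
    rintro (u | v) h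
    · exact G.loopless.irrefl _ h
    · exact B.loopless.irrefl _ h⟩

variable {G : SimpleGraph V} {B : SimpleGraph W} {c : B.Coloring Bool} {f : V → Bool → W}

theorem isCompound_compoundGraph (hc : ∀ v t, c (f v t) = t)
    (hf : ∀ t, Function.Injective fun v => f v t) : IsCompound G B (compoundGraph G B c f) where
  left _ _ := Iff.rfl
  right _ _ := Iff.rfl
  join := by
    refine ⟨c, fun v t => ⟨f v t, ⟨hc v t, ?_⟩, ?_⟩⟩
    · show f v (c (f v t)) = f v t
      rw [hc]
    · rintro w ⟨rfl, hw⟩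
      exact (show f v (c w) = w from hw).symm
  inj u v w hu hv := hf (c w) ((show f u (c w) = w from hu).trans (show f v (c w) = w from hv).symm)

theorem ncard_neighborSet_compound_inl [Finite V] [Finite W] (hc : ∀ v t, c (f v t) = t) (v : V) :
    ((compoundGraph G B c f).neighborSet (Sum.inl v)).ncard = (G.neighborSet v).ncard + 2 := by
  have hset : (compoundGraph G B c f).neighborSet (Sum.inl v) =
      Sum.inl '' G.neighborSet v ∪ Sum.inr '' {f v true, f v false} := by
    ext (u | w)
    · simp only [SimpleGraph.mem_neighborSet, Set.mem_union, Set.mem_image, Sum.inl.injEq,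
        exists_eq_right, reduceCtorEq, and_false, exists_false, or_false]
      exact Iff.rfl
    · simp only [SimpleGraph.mem_neighborSet, Set.mem_union, Set.mem_image, Sum.inr.injEq,
        exists_eq_right, reduceCtorEq, and_false, exists_false, false_or]
      show f v (c w) = w ↔ _
      constructor
      · intro hw
        cases h : c w <;> rw [h] at hw
        · exact Or.inr hw.symm
        · exact Or.inl hw.symm
      · rintro (rfl | rfl) <;> rw [hc]
  have hne : f v true ≠ f v false := fun h => by
    have := congrArg c h
    rw [hc, hc] at this
    exact absurd this (by decide)
  rw [hset, Set.ncard_union_eq, Set.ncard_image_of_injective _ Sum.inl_injective,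
    Set.ncard_image_of_injective _ Sum.inr_injective, Set.ncard_pair hne]
  rw [Set.disjoint_left]
  rintro _ ⟨u, -, rfl⟩ ⟨w, -, h⟩
  exact Sum.inr_ne_inl h

theorem ncard_neighborSet_compound_inr_le [Finite V] [Finite W]
    (hf : ∀ t, Function.Injective fun v => f v t) (w : W) :
    ((compoundGraph G B c f).neighborSet (Sum.inr w)).ncard ≤ (B.neighborSet w).ncard + 1 := by
  have hset : (compoundGraph G B c f).neighborSet (Sum.inr w) ⊆
      Sum.inr '' B.neighborSet w ∪ Sum.inl '' {v | f v (c w) = w} := by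
    rintro (u | w') h
    · exact Or.inr ⟨u, h, rfl⟩
    · exact Or.inl ⟨w', h, rfl⟩
  refine (Set.ncard_le_ncard hset (Set.toFinite _)).trans ((Set.ncard_union_le _ _).trans ?_)
  rw [Set.ncard_image_of_injective _ Sum.inr_injective,
    Set.ncard_image_of_injective _ Sum.inl_injective]
  gcongr
  rw [Set.ncard_le_one]
  intro a ha b hb
  exact hf (c w) (Eq.trans ha hb.symm)

theorem ncard_neighborSet_compound_inr [Finite W] {w : W}
    (hw : ∀ v, f v (c w) ≠ w) :
    ((compoundGraph G B c f).neighborSet (Sum.inr w)).ncard = (B.neighborSet w).ncard := by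
  have hset : (compoundGraph G B c f).neighborSet (Sum.inr w) = Sum.inr '' B.neighborSet w := by
    ext (u | w')
    · simp only [SimpleGraph.mem_neighborSet, Set.mem_image, reduceCtorEq, and_false, exists_false,
        iff_false]
      exact hw u
    · simp only [SimpleGraph.mem_neighborSet, Set.mem_image, Sum.inr.injEq, exists_eq_right]
      exact Iff.rfl
  rw [hset, Set.ncard_image_of_injective _ Sum.inr_injective]

theorem near_six_compound {q : ℕ} (hB : IsGeneralizedHexagon q B) (hG : ∀ u v, Near G 6 u v)
    (hc : ∀ v t, c (f v t) = t) (a b : V ⊕ W) : Near (compoundGraph G B c f) 6 a b := by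
  have hle := dist_le_of_ediam_le hB.diameter.le
  have hconn := hB.connected
  let ι : B →g compoundGraph G B c f := ⟨Sum.inr, fun h => h⟩
  let κ : G →g compoundGraph G B c f := ⟨Sum.inl, fun h => h⟩
  have mixed : ∀ v w, Near (compoundGraph G B c f) 6 (Sum.inl v) (Sum.inr w) := by
    intro v w
    -- Opposite colours make the distance odd, so it cannot be 6.
    have hd : B.dist (f v !c w) w ≤ 5 := by
      have h1 := hle (f v !c w) w
      have h2 := even_dist_iff hconn c (f v !c w) w
      rw [hc] at h2
      have h3 : ¬ Even (B.dist (f v !c w) w) := fun h => by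
        simpa using h2.1 h
      have h4 : B.dist (f v !c w) w ≠ 6 := fun h => h3 (by rw [h]; decide)
      omega
    have ha : (compoundGraph G B c f).Adj (Sum.inl v) (Sum.inr (f v !c w)) := by
      show f v (c (f v !c w)) = f v !c w
      rw [hc]
    exact ((Near.of_dist_le hconn hd).map ι).cons ha
  rcases a with u | w <;> rcases b with v | w'
  · exact (hG u v).map κ
  · exact mixed u w'
  · exact (mixed v w).symm
  · exact (Near.of_dist_le hconn (hle w w')).map ι

theorem exists_matching [Finite V] [Finite W] (c : W → Bool)
    (h : ∀ t, Nat.card V ≤ Nat.card {w // c w = t}) :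
    ∃ f : V → Bool → W, (∀ v t, c (f v t) = t) ∧ ∀ t, Function.Injective fun v => f v t := by
  have hex : ∀ t, ∃ e : V → {w // c w = t}, Function.Injective e := fun t =>
    ⟨fun v => (Finite.equivFin _).symm (Fin.castLE (h t) (Finite.equivFin V v)), fun u v huv => by
      simpa using huv⟩
  choose e he using hex
  exact ⟨fun v t => e t v, fun v t => (e t v).2, fun t u v huv => he t (Subtype.ext huv)⟩

theorem exists_unmatched [Finite V] [Finite W] (hc : ∀ v t, c (f v t) = t)
    (h : Nat.card V < Nat.card {w // c w = true}) : ∃ w, ∀ v, f v (c w) ≠ w := by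
  by_contra hcon
  push Not at hcon
  refine absurd (Nat.card_le_card_of_surjective
    (fun v => (⟨f v true, hc v true⟩ : {w // c w = true})) ?_) (not_le.2 h)
  rintro ⟨w, hw⟩
  obtain ⟨v, hv⟩ := hcon w
  rw [hw] at hv
  exact ⟨v, Subtype.ext hv⟩

theorem exists_compound [Finite V] (hG : HasOrderDegreeDiameter G 2754 5 6)
    (hB : IsGeneralizedHexagon 5 B) :
    ∃ C : SimpleGraph (V ⊕ W), IsCompound G B C ∧ HasOrderDegreeDiameter C 10566 7 6 := by
  have := IsBipartiteMoore.finite (by norm_num) hB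
  obtain ⟨c⟩ := hB.coloring
  have hW : Nat.card W = 2 * 3906 := by
    rw [hB.order]
    norm_num [Finset.sum_range_succ]
  have hcol := card_color (by norm_num) hB.regular c hW
  obtain ⟨hV, ⟨⟨v₀, hv₀⟩, hdeg⟩, hdiam⟩ := hG
  have hdegG : ∀ v, (G.neighborSet v).ncard ≤ 5 := fun v => hdeg ⟨v, rfl⟩
  obtain ⟨f, hc, hf⟩ := exists_matching (V := V) c fun t => by rw [hV, hcol]; norm_num
  -- An unmatched vertex keeps degree 6 and is the root for the Moore bound.
  obtain ⟨w₀, hw₀⟩ := exists_unmatched hc (by rw [hV, hcol]; norm_num)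
  have hcard : Nat.card (V ⊕ W) = 10566 := by rw [Nat.card_sum, hV, hW]
  have hdegC : ∀ x, ((compoundGraph G B c f).neighborSet x).ncard ≤ 7 := by
    rintro (v | w)
    · rw [ncard_neighborSet_compound_inl hc]
      have := hdegG v
      omega
    · refine (ncard_neighborSet_compound_inr_le hf w).trans ?_
      rw [hB.regular]
  refine ⟨compoundGraph G B c f, isCompound_compoundGraph hc hf, hcard, ⟨⟨Sum.inl v₀, ?_⟩, ?_⟩, ?_⟩
  · show ((compoundGraph G B c f).neighborSet (Sum.inl v₀)).ncard = 7
    rw [ncard_neighborSet_compound_inl hc]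
    exact congrArg (· + 2) hv₀
  · rintro _ ⟨x, rfl⟩
    exact hdegC x
  · refine ediam_eq_six (d := 6) (k := 6) (Sum.inr w₀) hdegC ?_ (by rw [hcard]; norm_num)
      (near_six_compound hB (fun u v => SimpleGraph.edist_le_ediam.trans hdiam.le) hc)
    rw [ncard_neighborSet_compound_inr hw₀, hB.regular]

end Compound

/-! ### Split octonions -/

section Octonion

variable {F : Type*} [Field F]

/-- The product of split octonions, written as Zorn vector matrices
`(x 0, (x 1, x 2, x 3); (x 4, x 5, x 6), x 7)`. -/
def omul (x y : Fin 8 → F) : Fin 8 → F :=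
  ![x 0 * y 0 + (x 1 * y 4 + x 2 * y 5 + x 3 * y 6),
    x 0 * y 1 + y 7 * x 1 - (x 5 * y 6 - x 6 * y 5),
    x 0 * y 2 + y 7 * x 2 - (x 6 * y 4 - x 4 * y 6),
    x 0 * y 3 + y 7 * x 3 - (x 4 * y 5 - x 5 * y 4),
    y 0 * x 4 + x 7 * y 4 + (x 2 * y 3 - x 3 * y 2),
    y 0 * x 5 + x 7 * y 5 + (x 3 * y 1 - x 1 * y 3),
    y 0 * x 6 + x 7 * y 6 + (x 1 * y 2 - x 2 * y 1),
    x 7 * y 7 + (x 4 * y 1 + x 5 * y 2 + x 6 * y 3)]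

/-- The conjugate of a split octonion. -/
def oconj (x : Fin 8 → F) : Fin 8 → F :=
  ![x 7, - x 1, - x 2, - x 3, - x 4, - x 5, - x 6, x 0]

/-- The norm of a split octonion. -/
def onorm (x : Fin 8 → F) : F := x 0 * x 7 - (x 1 * x 4 + x 2 * x 5 + x 3 * x 6)

/-- The polar form of the norm. -/
def opolar (x y : Fin 8 → F) : F :=
  x 0 * y 7 + y 0 * x 7 - (x 1 * y 4 + x 2 * y 5 + x 3 * y 6) -
    (y 1 * x 4 + y 2 * x 5 + y 3 * x 6)

/-- The trace of a split octonion. -/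
def otrace : (Fin 8 → F) →ₗ[F] F where
  toFun x := x 0 + x 7
  map_add' x y := by
    simp only [Pi.add_apply]
    ring
  map_smul' c x := by
    simp only [Pi.smul_apply, smul_eq_mul, RingHom.id_apply]
    ring

theorem otrace_apply (x : Fin 8 → F) : otrace x = x 0 + x 7 := rfl

/-- Left multiplication by a split octonion. -/
def lmul (x : Fin 8 → F) : (Fin 8 → F) →ₗ[F] (Fin 8 → F) where
  toFun := omul x
  map_add' y z := by
    ext i
    fin_cases i <;> simp [omul] <;> ring
  map_smul' c y := by
    ext i
    fin_cases i <;> simp [omul] <;> ring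

theorem lmul_apply (x y : Fin 8 → F) : lmul x y = omul x y := rfl

theorem omul_add (x y z : Fin 8 → F) : omul x (y + z) = omul x y + omul x z := (lmul x).map_add y z

theorem omul_smul (c : F) (x y : Fin 8 → F) : omul x (c • y) = c • omul x y :=
  (lmul x).map_smul c y

theorem add_omul (x y z : Fin 8 → F) : omul (x + y) z = omul x z + omul y z := by
  ext i
  fin_cases i <;> simp [omul] <;> ring

theorem smul_omul (c : F) (x y : Fin 8 → F) : omul (c • x) y = c • omul x y := by
  ext i
  fin_cases i <;> simp [omul] <;> ring

/-- The polarised form of `omul_omul_oconj`; such identities replace associativity and hold in every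
characteristic, including 2. -/
theorem omul_oconj_add (x z y : Fin 8 → F) :
    omul x (omul (oconj z) y) + omul z (omul (oconj x) y) = opolar x z • y := by
  ext i
  fin_cases i <;> simp [omul, oconj, opolar] <;> ring

theorem omul_omul_oconj (x y : Fin 8 → F) : omul x (omul (oconj x) y) = onorm x • y := by
  ext i
  fin_cases i <;> simp [omul, oconj, onorm] <;> ring

theorem omul_omul_oconj_right (x y : Fin 8 → F) : omul (omul x y) (oconj y) = onorm y • x := by
  ext i
  fin_cases i <;> simp [omul, oconj, onorm] <;> ring

theorem oconj_omul (x y : Fin 8 → F) : oconj (omul x y) = omul (oconj y) (oconj x) := by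
  ext i
  fin_cases i <;> simp [omul, oconj] <;> ring

theorem onorm_omul (x y : Fin 8 → F) : onorm (omul x y) = onorm x * onorm y := by
  simp [omul, onorm]; ring

theorem oconj_of_otrace {x : Fin 8 → F} (hx : otrace x = 0) : oconj x = (-1 : F) • x := by
  rw [otrace_apply] at hx
  have h7 : x 7 = - x 0 := by linear_combination hx
  ext i
  fin_cases i <;> simp [oconj, h7]

theorem omul_self {x : Fin 8 → F} (hx : otrace x = 0) :
    omul x x = (- onorm x) • ![1, 0, 0, 0, 0, 0, 0, 1] := by
  rw [otrace_apply] at hx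
  have h7 : x 7 = - x 0 := by linear_combination hx
  ext i
  fin_cases i <;> simp [omul, onorm, h7] <;> ring

theorem omul_self_eq_zero_iff {x : Fin 8 → F} (hx : otrace x = 0) :
    omul x x = 0 ↔ onorm x = 0 := by
  rw [omul_self hx]
  refine ⟨fun h => ?_, fun h => by simp [h]⟩
  simpa using congrFun h 0

/-- Conjugation reverses products and is `-1` on trace zero elements. -/
theorem omul_comm_zero {x y : Fin 8 → F} (hx : otrace x = 0) (hy : otrace y = 0)
    (h : omul x y = 0) : omul y x = 0 := by
  have h1 := oconj_omul x y
  rw [h, oconj_of_otrace hx, oconj_of_otrace hy, omul_smul, smul_omul, smul_smul] at h1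
  norm_num at h1
  rw [← h1]
  ext i
  fin_cases i <;> simp [oconj]

theorem omul_omul_self {x : Fin 8 → F} (hx : otrace x = 0) (hn : onorm x = 0) (y : Fin 8 → F) :
    omul x (omul x y) = 0 := by
  have h := omul_omul_oconj x y
  rw [oconj_of_otrace hx, smul_omul, omul_smul, hn, zero_smul] at h
  simpa using h

theorem omul_self_omul {y : Fin 8 → F} (hy : otrace y = 0) (hn : onorm y = 0) (x : Fin 8 → F) :
    omul (omul x y) y = 0 := by
  have h := omul_omul_oconj_right x y
  rw [oconj_of_otrace hy, omul_smul, hn, zero_smul] at h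
  simpa using h

theorem onorm_eq_zero_of_omul {x y : Fin 8 → F} (hx : x ≠ 0) (h : omul x y = 0) :
    onorm y = 0 := by
  have h1 := omul_omul_oconj_right x y
  have h2 : omul (0 : Fin 8 → F) (oconj y) = 0 := by
    ext i
    fin_cases i <;> simp [omul]
  rw [h, h2] at h1
  exact (smul_eq_zero.1 h1.symm).resolve_right hx

theorem exists_opolar_eq_one {x : Fin 8 → F} (hx : x ≠ 0) : ∃ z, opolar x z = 1 := by
  have key : ∃ z, opolar x z ≠ 0 := by
    by_contra hcon
    push Not at hcon
    apply hx
    ext i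
    fin_cases i
    · simpa [opolar] using hcon (Pi.single 7 1)
    · simpa [opolar] using hcon (Pi.single 4 1)
    · simpa [opolar] using hcon (Pi.single 5 1)
    · simpa [opolar] using hcon (Pi.single 6 1)
    · simpa [opolar] using hcon (Pi.single 1 1)
    · simpa [opolar] using hcon (Pi.single 2 1)
    · simpa [opolar] using hcon (Pi.single 3 1)
    · simpa [opolar] using hcon (Pi.single 0 1)
  obtain ⟨z, hz⟩ := key
  refine ⟨(opolar x z)⁻¹ • z, ?_⟩
  rw [show opolar x ((opolar x z)⁻¹ • z) = (opolar x z)⁻¹ * opolar x z by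
    simp only [opolar, Pi.smul_apply, smul_eq_mul]; ring, inv_mul_cancel₀ hz]

theorem otrace_omul (x z : Fin 8 → F) :
    otrace (omul x (oconj z)) = opolar x z := by
  simp [otrace_apply, omul, oconj, opolar]; ring

/-- If `x y = 0` and the polar form of `x` and `z` is 1, the polarised identity leaves `y = x (z̄
y)`. -/
theorem range_lmul_eq_ker {x : Fin 8 → F} (hx0 : x ≠ 0) (hx : otrace x = 0) (hn : onorm x = 0) :
    LinearMap.range (lmul x) = LinearMap.ker (lmul x) := by
  ext y
  rw [LinearMap.mem_ker, lmul_apply, LinearMap.mem_range]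
  constructor
  · rintro ⟨y, rfl⟩
    exact omul_omul_self hx hn y
  · intro hy
    obtain ⟨z, hz⟩ := exists_opolar_eq_one hx0
    refine ⟨omul (oconj z) y, ?_⟩
    have h := omul_oconj_add x z y
    rw [oconj_of_otrace hx, smul_omul, hy, hz, smul_zero, one_smul, ← lmul_apply z,
      map_zero, add_zero] at h
    exact h

/-- The trace zero right annihilator of `x`. -/
def annihilator (x : Fin 8 → F) : Submodule F (Fin 8 → F) :=
  LinearMap.ker (lmul x) ⊓ LinearMap.ker otrace

theorem mem_annihilator {x y : Fin 8 → F} : y ∈ annihilator x ↔ omul x y = 0 ∧ otrace y = 0 :=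
  Iff.rfl

/-- Kernel and range of `lmul x` coincide, so both have dimension 4. The trace is not zero on them,
because `x z̄` has trace `opolar x z`. -/
theorem finrank_annihilator {x : Fin 8 → F} (hx0 : x ≠ 0) (hx : otrace x = 0) (hn : onorm x = 0) :
    Module.finrank F (annihilator x) = 3 := by
  have h1 := LinearMap.finrank_range_add_finrank_ker (lmul x)
  rw [range_lmul_eq_ker hx0 hx hn, Module.finrank_fin_fun] at h1
  let φ : LinearMap.ker (lmul x) →ₗ[F] F := otrace.comp (LinearMap.ker (lmul x)).subtype
  have hφ : Function.Surjective φ := by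
    obtain ⟨z, hz⟩ := exists_opolar_eq_one hx0
    intro c
    refine ⟨c • ⟨omul x (oconj z), omul_omul_self hx hn _⟩, ?_⟩
    rw [map_smul]
    show c • otrace (omul x (oconj z)) = c
    rw [otrace_omul, hz, smul_eq_mul, mul_one]
  have h2 := LinearMap.finrank_range_add_finrank_ker φ
  rw [LinearMap.range_eq_top.2 hφ, finrank_top, Module.finrank_self] at h2
  have h3 : annihilator x = (LinearMap.ker φ).map (LinearMap.ker (lmul x)).subtype := by
    ext y
    simp only [annihilator, Submodule.mem_inf, Submodule.mem_map, φ, LinearMap.mem_ker]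
    constructor
    · rintro ⟨ha, hb⟩
      exact ⟨⟨y, ha⟩, hb, rfl⟩
    · rintro ⟨⟨y, ha⟩, hb, rfl⟩
      exact ⟨ha, hb⟩
  rw [h3, Submodule.finrank_map_subtype_eq]
  omega

end Octonion

/-! ### Counting subspaces and isotropic vectors -/

section Counting

variable {F : Type*} [Field F]

theorem ncard_lines_le {M : Type*} [AddCommGroup M] [Module F M] [Finite F]
    {A : Submodule F M} (hA : Module.finrank F A = 2) :
    {p : Submodule F M | p ≤ A ∧ Module.finrank F p = 1}.ncard = Nat.card F + 1 := by
  have h1 := Projectivization.card_of_finrank_two F A hA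
  rw [Nat.card_congr (Projectivization.equivSubmodule F A)] at h1
  rw [← h1]
  have himg : (fun p : Submodule F A => p.map A.subtype) '' {p | Module.finrank F p = 1} =
      {p : Submodule F M | p ≤ A ∧ Module.finrank F p = 1} := by
    ext p
    constructor
    · rintro ⟨p, hp, rfl⟩
      refine ⟨Submodule.map_subtype_le A p, ?_⟩
      rw [Submodule.finrank_map_subtype_eq]
      exact hp
    · rintro ⟨hp, hf⟩
      refine ⟨p.comap A.subtype, ?_, ?_⟩
      · have := Submodule.finrank_map_subtype_eq A (p.comap A.subtype)
        rw [Submodule.map_comap_subtype, inf_eq_right.2 hp, hf] at this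
        exact this.symm
      · show (p.comap A.subtype).map A.subtype = p
        rw [Submodule.map_comap_subtype, inf_eq_right.2 hp]
  rw [← himg, Set.ncard_image_of_injective _ (Submodule.map_injective_of_injective A.injective_subtype)]
  rfl

theorem finrank_comap_mkQ {M : Type*} [AddCommGroup M] [Module F M] [FiniteDimensional F M]
    (p : Submodule F M) (L : Submodule F (M ⧸ p)) :
    Module.finrank F (L.comap p.mkQ) = Module.finrank F L + Module.finrank F p := by
  have h1 := LinearMap.finrank_range_add_finrank_ker (p.mkQ.domRestrict (L.comap p.mkQ))
  have h2 : LinearMap.range (p.mkQ.domRestrict (L.comap p.mkQ)) = L := by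
    rw [LinearMap.range_domRestrict, Submodule.map_comap_eq_of_surjective p.mkQ_surjective]
  have h3 : (LinearMap.ker (p.mkQ.domRestrict (L.comap p.mkQ))).map (L.comap p.mkQ).subtype = p := by
    ext x
    simp only [Submodule.mem_map, LinearMap.mem_ker, LinearMap.domRestrict_apply, Submodule.mkQ_apply,
      Submodule.Quotient.mk_eq_zero, Submodule.subtype_apply, Subtype.exists, Submodule.mem_comap]
    constructor
    · rintro ⟨y, hy, hp, rfl⟩
      exact hp
    · intro hx
      exact ⟨x, by simp [(Submodule.Quotient.mk_eq_zero p).2 hx], hx, rfl⟩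
  have h4 := Submodule.finrank_map_subtype_eq (L.comap p.mkQ)
    (LinearMap.ker (p.mkQ.domRestrict (L.comap p.mkQ)))
  rw [h3] at h4
  rw [h2] at h1
  omega

/-- Modulo `p` these are the 1-dimensional subspaces of a 2-dimensional space. -/
theorem ncard_planes_between {M : Type*} [AddCommGroup M] [Module F M] [FiniteDimensional F M]
    [Finite F] {p A : Submodule F M} (hpA : p ≤ A) (hp : Module.finrank F p = 1)
    (hA : Module.finrank F A = 3) :
    {L : Submodule F M | p ≤ L ∧ L ≤ A ∧ Module.finrank F L = 2}.ncard = Nat.card F + 1 := by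
  have hcm : ∀ L : Submodule F M, p ≤ L → (L.map p.mkQ).comap p.mkQ = L := fun L hL => by
    rw [Submodule.comap_map_mkQ, sup_eq_right.2 hL]
  have hA2 : Module.finrank F (A.map p.mkQ) = 2 := by
    have := finrank_comap_mkQ p (A.map p.mkQ)
    rw [hcm A hpA] at this
    omega
  rw [← ncard_lines_le hA2]
  have himg : Submodule.comap p.mkQ '' {L | L ≤ A.map p.mkQ ∧ Module.finrank F L = 1} =
      {L : Submodule F M | p ≤ L ∧ L ≤ A ∧ Module.finrank F L = 2} := by
    ext L
    constructor
    · rintro ⟨L, ⟨hL, hf⟩, rfl⟩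
      refine ⟨?_, ?_, ?_⟩
      · exact (Submodule.le_comap_mkQ p L)
      · rw [← hcm A hpA]
        exact Submodule.comap_mono hL
      · rw [finrank_comap_mkQ, hf, hp]
    · rintro ⟨hpL, hLA, hf⟩
      refine ⟨L.map p.mkQ, ⟨Submodule.map_mono hLA, ?_⟩, hcm L hpL⟩
      have := finrank_comap_mkQ p (L.map p.mkQ)
      rw [hcm L hpL] at this
      omega
  rw [← himg, Set.ncard_image_of_injective _
    (Submodule.comap_injective_of_surjective p.mkQ_surjective)]

/-- The number of solutions of a nontrivial linear equation in three variables. -/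
theorem card_dot_eq [Fintype F] [DecidableEq F] {u : Fin 3 → F} (hu : u ≠ 0) (c : F) :
    (Finset.univ.filter fun v : Fin 3 → F => u 0 * v 0 + u 1 * v 1 + u 2 * v 2 = c).card =
      Fintype.card F ^ 2 := by
  let φ : (Fin 3 → F) →+ F :=
    { toFun := fun v => u 0 * v 0 + u 1 * v 1 + u 2 * v 2
      map_zero' := by simp
      map_add' := fun v w => by simp; ring }
  have hsurj : Function.Surjective φ := by
    have : ∃ i, u i ≠ 0 := by
      by_contra hcon
      push Not at hcon
      exact hu (funext hcon)
    obtain ⟨i, hi⟩ := this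
    intro c
    refine ⟨Pi.single i ((u i)⁻¹ * c), ?_⟩
    show u 0 * _ + u 1 * _ + u 2 * _ = c
    fin_cases i <;> simp_all
  have hfib : ∀ d, (Finset.univ.filter fun v => φ v = d).card =
      (Finset.univ.filter fun v => φ v = c).card := fun d =>
    AddMonoidHom.card_fiber_eq_of_mem_range φ (hsurj d) (hsurj c)
  have hsum := Finset.card_eq_sum_card_fiberwise (s := Finset.univ) (t := Finset.univ) (f := φ)
    (fun _ _ => by simp)
  rw [Finset.sum_congr rfl fun d _ => hfib d, Finset.sum_const, Finset.card_univ, Finset.card_univ,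
    Fintype.card_fun, Fintype.card_fin, smul_eq_mul, pow_succ'] at hsum
  exact (Nat.eq_of_mul_eq_mul_left Fintype.card_pos hsum).symm

/-- The number of zeros of a nondegenerate quadratic form in seven variables. -/
theorem card_quadric [Fintype F] [DecidableEq F] :
    (Finset.univ.filter fun x : (Fin 3 → F) × F × (Fin 3 → F) =>
      x.1 0 * x.2.2 0 + x.1 1 * x.2.2 1 + x.1 2 * x.2.2 2 = - (x.2.1 * x.2.1)).card =
      Fintype.card F ^ 6 := by
  set q := Fintype.card F with hq
  have hq0 : 0 < q := Fintype.card_pos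
  have hin : ∀ u : Fin 3 → F, (Finset.univ.filter fun y : F × (Fin 3 → F) =>
      u 0 * y.2 0 + u 1 * y.2 1 + u 2 * y.2 2 = - (y.1 * y.1)).card = q ^ 3 := by
    intro u
    -- Both cases give `q ^ 3`: for `u = 0` the scalar vanishes and the last vector is free;
    -- otherwise each scalar leaves `q ^ 2` vectors.
    by_cases hu : u = 0
    · subst hu
      have : (Finset.univ.filter fun y : F × (Fin 3 → F) =>
          (0 : Fin 3 → F) 0 * y.2 0 + (0 : Fin 3 → F) 1 * y.2 1 + (0 : Fin 3 → F) 2 * y.2 2 =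
            - (y.1 * y.1)) = {0} ×ˢ Finset.univ := by
        ext ⟨a, v⟩
        simp [eq_comm]
      rw [this, Finset.card_product, Finset.card_singleton, Finset.card_univ, Fintype.card_fun,
        Fintype.card_fin, one_mul]
    · rw [Finset.card_filter, Fintype.sum_prod_type]
      simp only
      rw [Finset.sum_congr rfl fun a _ => by
        rw [← Finset.card_filter, card_dot_eq hu], Finset.sum_const, Finset.card_univ, smul_eq_mul]
      ring
  rw [Finset.card_filter, Fintype.sum_prod_type]
  rw [Finset.sum_congr rfl fun u _ => by rw [← Finset.card_filter, hin u], Finset.sum_const,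
    Finset.card_univ, Fintype.card_fun, Fintype.card_fin, smul_eq_mul]
  ring

/-- Trace zero means `x 7 = - x 0`, which turns the norm equation into the seven-variable quadric.
-/
theorem card_isotropic [Fintype F] [DecidableEq F] :
    (Finset.univ.filter fun x : Fin 8 → F => otrace x = 0 ∧ onorm x = 0).card =
      Fintype.card F ^ 6 := by
  rw [← card_quadric]
  refine Finset.card_bij' (fun x _ => (![x 1, x 2, x 3], x 0, ![x 4, x 5, x 6]))
    (fun y _ => ![y.2.1, y.1 0, y.1 1, y.1 2, y.2.2 0, y.2.2 1, y.2.2 2, - y.2.1]) ?_ ?_ ?_ ?_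
  · intro x hx
    obtain ⟨-, h1, h2⟩ := Finset.mem_filter.1 hx
    rw [otrace_apply] at h1
    rw [onorm] at h2
    refine Finset.mem_filter.2 ⟨Finset.mem_univ _, ?_⟩
    simp
    linear_combination x 0 * h1 - h2
  · intro y hy
    obtain ⟨-, h1⟩ := Finset.mem_filter.1 hy
    refine Finset.mem_filter.2 ⟨Finset.mem_univ _, ?_, ?_⟩
    · simp [otrace_apply]
    · simp [onorm]
      linear_combination - h1
  · intro x hx
    obtain ⟨-, h1, h2⟩ := Finset.mem_filter.1 hx
    rw [otrace_apply] at h1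
    have h7 : - x 0 = x 7 := by linear_combination - h1
    ext i
    fin_cases i <;> simp [h7]
  · rintro ⟨u, a, v⟩ hy
    simp only [Prod.mk.injEq]
    refine ⟨?_, ?_, ?_⟩
    · ext i
      fin_cases i <;> simp
    · simp
    · ext i
      fin_cases i <;> simp

end Counting

/-! ### The split Cayley hexagon -/

section SplitCayley

variable {F : Type*} [Field F]

/-- A subspace of trace zero split octonions on which the multiplication vanishes. -/
def IsNull (U : Submodule F (Fin 8 → F)) : Prop :=
  (∀ x ∈ U, otrace x = 0) ∧ ∀ x ∈ U, ∀ y ∈ U, omul x y = 0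

theorem IsNull.mono {U U' : Submodule F (Fin 8 → F)} (h : IsNull U') (hU : U ≤ U') : IsNull U :=
  ⟨fun x hx => h.1 x (hU hx), fun x hx y hy => h.2 x (hU hx) y (hU hy)⟩

theorem IsNull.sup {U U' : Submodule F (Fin 8 → F)} (h : IsNull U) (h' : IsNull U')
    (hm : ∀ x ∈ U, ∀ y ∈ U', omul x y = 0) : IsNull (U ⊔ U') := by
  constructor
  · intro x hx
    obtain ⟨a, ha, b, hb, rfl⟩ := Submodule.mem_sup.1 hx
    rw [map_add, h.1 a ha, h'.1 b hb, add_zero]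
  · intro x hx y hy
    obtain ⟨a, ha, b, hb, rfl⟩ := Submodule.mem_sup.1 hx
    obtain ⟨c, hc, d, hd, rfl⟩ := Submodule.mem_sup.1 hy
    rw [add_omul, omul_add, omul_add, h.2 a ha c hc, h'.2 b hb d hd, hm a ha d hd,
      omul_comm_zero (h.1 c hc) (h'.1 b hb) (hm c hc b hb)]
    simp

theorem isNull_span_singleton {x : Fin 8 → F} (hx : otrace x = 0) (hn : onorm x = 0) :
    IsNull (Submodule.span F {x}) := by
  constructor
  · intro y hy
    obtain ⟨c, rfl⟩ := Submodule.mem_span_singleton.1 hy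
    rw [map_smul, hx, smul_zero]
  · intro y hy z hz
    obtain ⟨c, rfl⟩ := Submodule.mem_span_singleton.1 hy
    obtain ⟨d, rfl⟩ := Submodule.mem_span_singleton.1 hz
    rw [omul_smul, smul_omul, (omul_self_eq_zero_iff hx).2 hn, smul_zero, smul_zero]

theorem IsNull.onorm_eq_zero {U : Submodule F (Fin 8 → F)} (h : IsNull U) {x : Fin 8 → F}
    (hx : x ∈ U) : onorm x = 0 :=
  (omul_self_eq_zero_iff (h.1 x hx)).1 (h.2 x hx x hx)

theorem exists_span_of_finrank_one {U : Submodule F (Fin 8 → F)} (h : Module.finrank F U = 1) :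
    ∃ x, x ≠ 0 ∧ x ∈ U ∧ U = Submodule.span F {x} := by
  obtain ⟨⟨x, hx⟩, hx0, hs⟩ := finrank_eq_one_iff'.1 h
  refine ⟨x, fun h0 => hx0 (Subtype.ext h0), hx, le_antisymm (fun y hy => ?_) ?_⟩
  · obtain ⟨c, hc⟩ := hs ⟨y, hy⟩
    exact Submodule.mem_span_singleton.2 ⟨c, congrArg Subtype.val hc⟩
  · rwa [Submodule.span_singleton_le_iff_mem]

variable (F) in
/-- The points and lines of the split Cayley hexagon. -/
def HexVertex : Type _ :=
  {U : Submodule F (Fin 8 → F) // IsNull U ∧ (Module.finrank F U = 1 ∨ Module.finrank F U = 2)}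

variable (F) in
/-- The incidence graph of the split Cayley hexagon. -/
def splitCayley : SimpleGraph (HexVertex F) where
  Adj U U' := U.1 < U'.1 ∨ U'.1 < U.1
  symm := ⟨fun _ _ h => h.symm⟩
  loopless := ⟨fun U h => h.elim (lt_irrefl U.1) (lt_irrefl U.1)⟩

variable (F) in
open Classical in
/-- The colouring of the points and lines of the split Cayley hexagon by their type. -/
noncomputable def splitCayleyColoring : (splitCayley F).Coloring Bool :=
  SimpleGraph.Coloring.mk (fun U => decide (Module.finrank F U.1 = 1)) fun {U U'} h he => by
    have h1 : Module.finrank F U.1 < Module.finrank F U'.1 ∨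
        Module.finrank F U'.1 < Module.finrank F U.1 :=
      h.imp Submodule.finrank_lt_finrank_of_lt Submodule.finrank_lt_finrank_of_lt
    have h2 := U.2.2
    have h3 := U'.2.2
    simp only [decide_eq_decide] at he
    omega

theorem splitCayleyColoring_eq_true {U : HexVertex F} :
    splitCayleyColoring F U = true ↔ Module.finrank F U.1 = 1 := by
  classical
  show decide _ = true ↔ _
  rw [decide_eq_true_iff]

instance [Finite F] : Finite (HexVertex F) :=
  have : Finite (Submodule F (Fin 8 → F)) := Finite.of_injective _ SetLike.coe_injective
  Subtype.finite

theorem ncard_neighborSet_splitCayley [Finite F] (U : HexVertex F) :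
    ((splitCayley F).neighborSet U).ncard = Nat.card F + 1 := by
  have hinj : Function.Injective (Subtype.val : HexVertex F → Submodule F (Fin 8 → F)) :=
    Subtype.val_injective
  refine (Set.ncard_image_of_injective _ hinj).symm.trans ?_
  obtain ⟨U, hU, h1 | h2⟩ := U
  · obtain ⟨x, hx0, hxU, hUx⟩ := exists_span_of_finrank_one h1
    have hA := finrank_annihilator hx0 (hU.1 x hxU) (hU.onorm_eq_zero hxU)
    have hUA : U ≤ annihilator x := fun y hy => ⟨hU.2 x hxU y hy, hU.1 y hy⟩
    rw [← ncard_planes_between hUA h1 hA]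
    congr 1
    ext L
    constructor
    · rintro ⟨⟨L, hL, hf⟩, hUL, rfl⟩
      have hlt : U < L := hUL.resolve_right fun hlt => by
        have := Submodule.finrank_lt_finrank_of_lt hlt
        simp only at this
        omega
      have := Submodule.finrank_lt_finrank_of_lt hlt
      exact ⟨hlt.le, fun y hy => ⟨hL.2 x (hlt.le hxU) y hy, hL.1 y hy⟩, by
        show Module.finrank F L = 2
        omega⟩
    · rintro ⟨hUL, hLA, hf⟩
      have hne : U ≠ L := by rintro rfl; omega
      have hlt : U < L := lt_of_le_of_ne hUL hne
      obtain ⟨y, hyL, hyU⟩ := SetLike.exists_of_lt hlt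
      have hy := mem_annihilator.1 (hLA hyL)
      have hyn := isNull_span_singleton hy.2 (onorm_eq_zero_of_omul hx0 hy.1)
      have hsup : L = U ⊔ Submodule.span F {y} := by
        refine (Submodule.eq_of_le_of_finrank_le (sup_le hUL (by
          rwa [Submodule.span_singleton_le_iff_mem])) ?_).symm
        have h3 : U < U ⊔ Submodule.span F {y} :=
          lt_of_le_of_ne le_sup_left fun he => hyU (by
            rw [he]
            exact (le_sup_right : _ ≤ U ⊔ _) (Submodule.mem_span_singleton_self y))
        have := Submodule.finrank_lt_finrank_of_lt h3
        omega
      have hL : IsNull L := by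
        rw [hsup]
        refine hU.sup hyn fun a ha b hb => ?_
        rw [hUx] at ha
        obtain ⟨c, rfl⟩ := Submodule.mem_span_singleton.1 ha
        obtain ⟨d, rfl⟩ := Submodule.mem_span_singleton.1 hb
        rw [omul_smul, smul_omul, hy.1, smul_zero, smul_zero]
      exact ⟨⟨L, hL, Or.inr hf⟩, Or.inl hlt, rfl⟩
  · rw [← ncard_lines_le h2]
    congr 1
    ext p
    constructor
    · rintro ⟨⟨p, hp, hf⟩, hUp, rfl⟩
      have hlt : p < U := hUp.resolve_left fun hlt => by
        have := Submodule.finrank_lt_finrank_of_lt hlt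
        simp only at this
        omega
      have := Submodule.finrank_lt_finrank_of_lt hlt
      exact ⟨hlt.le, by
        show Module.finrank F p = 1
        omega⟩
    · rintro ⟨hpU, hf⟩
      exact ⟨⟨p, hU.mono hpU, Or.inl hf⟩,
        Or.inr (lt_of_le_of_ne hpU fun h => by
          have h : p = U := h
          rw [h] at hf
          omega), rfl⟩

/-- Distinct points with product zero span a line of the hexagon. -/
theorem near_two_of_omul {U U' : HexVertex F} (h1 : Module.finrank F U.1 = 1)
    (h1' : Module.finrank F U'.1 = 1) (hm : ∀ x ∈ U.1, ∀ y ∈ U'.1, omul x y = 0) :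
    Near (splitCayley F) 2 U U' := by
  by_cases he : U = U'
  · subst he
    exact (Near.refl _).mono (by norm_num)
  have hne : U.1 ≠ U'.1 := fun h => he (Subtype.ext h)
  have hlt : U.1 < U.1 ⊔ U'.1 := lt_of_le_of_ne le_sup_left fun h => hne <|
    (Submodule.eq_of_le_of_finrank_le (h ▸ (le_sup_right : U'.1 ≤ U.1 ⊔ U'.1)) (by omega)).symm
  have hlt' : U'.1 < U.1 ⊔ U'.1 := lt_of_le_of_ne le_sup_right fun h => hne <|
    Submodule.eq_of_le_of_finrank_le (h ▸ (le_sup_left : U.1 ≤ U.1 ⊔ U'.1)) (by omega)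
  have hd1 := Submodule.finrank_lt_finrank_of_lt hlt
  have hd2 := Submodule.finrank_add_le_finrank_add_finrank U.1 U'.1
  let L : HexVertex F := ⟨U.1 ⊔ U'.1, U.2.1.sup U'.2.1 hm, Or.inr (by omega)⟩
  have a1 : (splitCayley F).Adj U L := Or.inl hlt
  have a2 : (splitCayley F).Adj L U' := Or.inr hlt'
  exact (Near.of_adj a2).cons a1

/-- A point and a line of the split Cayley hexagon have distance at most `5`. -/
theorem near_five_splitCayley {U L : HexVertex F} (h1 : Module.finrank F U.1 = 1)
    (h2 : Module.finrank F L.1 = 2) : Near (splitCayley F) 5 U L := by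
  obtain ⟨x, hx0, hxU, hUx⟩ := exists_span_of_finrank_one h1
  have hxt := U.2.1.1 x hxU
  have hxn := U.2.1.onorm_eq_zero hxU
  -- A linear functional on the 2-dimensional `L` vanishes at some nonzero `w`; here the functional
  -- is `w ↦ tr (x w)`.
  have hker := LinearMap.ker_ne_bot_of_finrank_lt
    (f := (otrace.comp (lmul x)).comp L.1.subtype) (by rw [h2, Module.finrank_self]; norm_num)
  obtain ⟨⟨w, hwL⟩, hwk, hw0⟩ := Submodule.exists_mem_ne_zero_of_ne_bot hker
  have hw0 : w ≠ 0 := fun h => hw0 (Subtype.ext h)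
  have hwk : otrace (omul x w) = 0 := hwk
  have hwt := L.2.1.1 w hwL
  have hwn := L.2.1.onorm_eq_zero hwL
  have hW1 := finrank_span_singleton (K := F) hw0
  let W : HexVertex F := ⟨Submodule.span F {w}, isNull_span_singleton hwt hwn, Or.inl hW1⟩
  have hWL : (splitCayley F).Adj W L := Or.inl (lt_of_le_of_ne
    ((Submodule.span_singleton_le_iff_mem _ _).2 hwL) fun h => by
      have h : Submodule.span F {w} = L.1 := h
      rw [h] at hW1
      omega)
  by_cases hp0 : omul x w = 0
  · have h3 : Near (splitCayley F) 2 U W := near_two_of_omul h1 hW1 fun a ha b hb => by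
      rw [hUx] at ha
      obtain ⟨c, rfl⟩ := Submodule.mem_span_singleton.1 ha
      obtain ⟨d, rfl⟩ := Submodule.mem_span_singleton.1 hb
      rw [omul_smul, smul_omul, hp0, smul_zero, smul_zero]
    exact (h3.trans (Near.of_adj hWL)).mono (by norm_num)
  -- Since `x (x w) = 0 = (x w) w`, the point `x w` is collinear with both, giving a path of length
  -- `2 + 2 + 1`.
  · have hP1 := finrank_span_singleton (K := F) hp0
    let P : HexVertex F := ⟨Submodule.span F {omul x w},
      isNull_span_singleton hwk (by rw [onorm_omul, hxn, zero_mul]), Or.inl hP1⟩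
    have h3 : Near (splitCayley F) 2 U P := near_two_of_omul h1 hP1 fun a ha b hb => by
      rw [hUx] at ha
      obtain ⟨c, rfl⟩ := Submodule.mem_span_singleton.1 ha
      obtain ⟨d, rfl⟩ := Submodule.mem_span_singleton.1 hb
      rw [omul_smul, smul_omul, omul_omul_self hxt hxn, smul_zero, smul_zero]
    have h4 : Near (splitCayley F) 2 P W := near_two_of_omul hP1 hW1 fun a ha b hb => by
      obtain ⟨c, rfl⟩ := Submodule.mem_span_singleton.1 ha
      obtain ⟨d, rfl⟩ := Submodule.mem_span_singleton.1 hb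
      rw [omul_smul, smul_omul, omul_self_omul hwt hwn, smul_zero, smul_zero]
    exact (h3.trans h4).trans (Near.of_adj hWL)

/-- For vertices of the same type, a neighbour of one has the other type and is within distance 5.
-/
theorem near_six_splitCayley [Finite F] (U U' : HexVertex F) :
    Near (splitCayley F) 6 U U' := by
  have hnb : ∃ M, (splitCayley F).Adj U' M := by
    have h : ((splitCayley F).neighborSet U').ncard ≠ 0 := by
      rw [ncard_neighborSet_splitCayley]
      omega
    exact Set.nonempty_of_ncard_ne_zero h
  obtain ⟨M, hM⟩ := hnb
  have hM' : Module.finrank F U'.1 < Module.finrank F M.1 ∨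
      Module.finrank F M.1 < Module.finrank F U'.1 :=
    hM.imp Submodule.finrank_lt_finrank_of_lt Submodule.finrank_lt_finrank_of_lt
  have hMr := M.2.2
  rcases U.2.2 with h1 | h2 <;> rcases U'.2.2 with h1' | h2'
  · exact (near_five_splitCayley h1 (by omega)).trans (Near.of_adj hM.symm)
  · exact (near_five_splitCayley h1 h2').mono (by norm_num)
  · exact (near_five_splitCayley h1' h2).symm.mono (by norm_num)
  · exact (near_five_splitCayley (by omega) h2).symm.trans (Near.of_adj hM.symm)

/-- The `q ^ 6 - 1` nonzero isotropic vectors of trace zero are partitioned by their spans, `q - 1`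
to each point. -/
theorem card_points_mul [Finite F] :
    Nat.card {U : HexVertex F // splitCayleyColoring F U = true} * (Nat.card F - 1) + 1 =
      Nat.card F ^ 6 := by
  classical
  have := Fintype.ofFinite F
  have : Finite (Submodule F (Fin 8 → F)) := Finite.of_injective _ SetLike.coe_injective
  have := Fintype.ofFinite (Submodule F (Fin 8 → F))
  let Z := Finset.univ.filter fun x : Fin 8 → F => otrace x = 0 ∧ onorm x = 0
  let T := Finset.univ.filter fun U : Submodule F (Fin 8 → F) => IsNull U ∧ Module.finrank F U = 1
  have hT : Nat.card {U : HexVertex F // splitCayleyColoring F U = true} = T.card := by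
    have e : {U : HexVertex F // splitCayleyColoring F U = true} ≃
        {U : Submodule F (Fin 8 → F) // IsNull U ∧ Module.finrank F U = 1} :=
      { toFun := fun U => ⟨U.1.1, U.1.2.1, splitCayleyColoring_eq_true.1 U.2⟩
        invFun := fun U => ⟨⟨U.1, U.2.1, Or.inl U.2.2⟩, splitCayleyColoring_eq_true.2 U.2.2⟩
        left_inv := fun _ => rfl
        right_inv := fun _ => rfl }
    rw [Nat.card_congr e, Nat.card_eq_fintype_card, Fintype.card_subtype]
  have h0 : (0 : Fin 8 → F) ∈ Z :=
    Finset.mem_filter.2 ⟨Finset.mem_univ _, map_zero _, by simp [onorm]⟩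
  have hZ : (Z.erase 0).card + 1 = Nat.card F ^ 6 := by
    rw [Finset.card_erase_add_one h0, Nat.card_eq_fintype_card]
    convert card_isotropic (F := F)
  rw [← hZ, hT, Finset.card_eq_sum_card_fiberwise (f := fun x => Submodule.span F {x}) (t := T)]
  · rw [← smul_eq_mul, ← Finset.sum_const]
    congr 1
    refine Finset.sum_congr rfl fun U hU => ?_
    obtain ⟨-, hU, hU1⟩ := Finset.mem_filter.1 hU
    have hset : ((Z.erase 0).filter fun x => Submodule.span F {x} = U) =
        (Finset.univ.filter fun x => x ∈ U).erase 0 := by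
      ext x
      simp only [Finset.mem_filter, Finset.mem_erase, Finset.mem_univ, true_and, Z]
      constructor
      · rintro ⟨⟨hx0, -⟩, rfl⟩
        exact ⟨hx0, Submodule.mem_span_singleton_self x⟩
      · rintro ⟨hx0, hx⟩
        refine ⟨⟨hx0, hU.1 x hx, hU.onorm_eq_zero hx⟩, ?_⟩
        refine Submodule.eq_of_le_of_finrank_le
          ((Submodule.span_singleton_le_iff_mem _ _).2 hx) ?_
        rw [hU1, finrank_span_singleton hx0]
    rw [hset, Finset.card_erase_of_mem (by simp)]
    have hc : Nat.card U = Nat.card F ^ 1 := hU1 ▸ Module.natCard_eq_pow_finrank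
    rw [pow_one, Nat.card_eq_fintype_card, Fintype.card_subtype] at hc
    rw [hc]
  · intro x hx
    have hx := Finset.mem_coe.1 hx
    obtain ⟨hx0, hx⟩ := Finset.mem_erase.1 hx
    obtain ⟨-, hx1, hx2⟩ := Finset.mem_filter.1 hx
    exact Finset.mem_coe.2 (Finset.mem_filter.2
      ⟨Finset.mem_univ _, isNull_span_singleton hx1 hx2, finrank_span_singleton hx0⟩)

theorem card_hexVertex [Finite F] :
    Nat.card (HexVertex F) = 2 * ∑ i ∈ Finset.range 6, Nat.card F ^ i := by
  have hq : 1 < Nat.card F := Finite.one_lt_card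
  have h1 := card_points_mul (F := F)
  have h2 : ∑ i ∈ Finset.range 6, Nat.card F ^ i =
      Nat.card {U : HexVertex F // splitCayleyColoring F U = true} := by
    obtain ⟨n, hn⟩ : ∃ n, Nat.card F = n + 1 := ⟨Nat.card F - 1, by omega⟩
    rw [hn] at h1 ⊢
    have h3 := geom_sum_mul_add n 6
    rw [← h1, Nat.add_sub_cancel] at h3
    exact Nat.eq_of_mul_eq_mul_right (by omega) (Nat.add_right_cancel h3)
  have h3 := card_color_eq (d := Nat.card F + 1) (by omega) ncard_neighborSet_splitCayley
    (splitCayleyColoring F)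
  have h4 := Set.ncard_add_ncard_compl {U : HexVertex F | splitCayleyColoring F U = true}
  have h5 : {U : HexVertex F | splitCayleyColoring F U = true}ᶜ =
    {U | splitCayleyColoring F U = false} := by ext; simp
  rw [h5] at h4
  rw [← h4, h2, two_mul]
  exact congrArg _ h3.symm

theorem isGeneralizedHexagon_splitCayley [Finite F] :
    IsGeneralizedHexagon (Nat.card F) (splitCayley F) where
  bipartite := (splitCayleyColoring F).colorable
  regular := ncard_neighborSet_splitCayley
  order := by rw [card_hexVertex, Nat.add_sub_cancel]
  diameter := by
    have hpos : 0 < Nat.card (HexVertex F) := by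
      rw [card_hexVertex]
      simp [Finset.sum_range_succ]
    obtain ⟨U⟩ := (Nat.card_pos_iff.1 hpos).1
    -- The bound for diameter 5 falls short of the order by exactly `q ^ 5`.
    refine ediam_eq_six (d := Nat.card F) (k := Nat.card F + 1) U
      (fun v => (ncard_neighborSet_splitCayley v).le) (ncard_neighborSet_splitCayley U).le ?_
      near_six_splitCayley
    rw [card_hexVertex]
    have : 0 < Nat.card F ^ 5 := pow_pos Nat.card_pos 5
    simp only [Finset.sum_range_succ, Finset.sum_range_zero]
    nlinarith

end SplitCayley

theorem mainTheorem5 :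
    (∃ (V : Type) (H₄ : SimpleGraph V), IsGeneralizedHexagon 4 H₄) ∧
    (∃ (W : Type) (H₅ : SimpleGraph W), IsGeneralizedHexagon 5 H₅) ∧
    ∀ (V W : Type) (H₄ : SimpleGraph V) (H₅ : SimpleGraph W),
      IsGeneralizedHexagon 4 H₄ → IsGeneralizedHexagon 5 H₅ →
      ∃ (r : V) (S : Set V) (G : SimpleGraph ({v : V // v ∉ S} ⊕ S × Fin 4)),
        S.ncard = 8 ∧ IsSubstitution H₄ r S 4 G ∧ HasOrderDegreeDiameter G 2754 5 6 ∧
        ∃ C : SimpleGraph (({v : V // v ∉ S} ⊕ S × Fin 4) ⊕ W),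
          IsCompound G H₅ C ∧ HasOrderDegreeDiameter C 10566 7 6 := by
  refine ⟨?_, ?_, ?_⟩
  · have hc : Nat.card (GaloisField 2 2) = 4 := by
      rw [GaloisField.card 2 2 (by norm_num)]
      norm_num
    exact ⟨_, _, hc ▸ isGeneralizedHexagon_splitCayley (F := GaloisField 2 2)⟩
  · have : Fact (Nat.Prime 5) := ⟨by norm_num⟩
    have hc : Nat.card (ZMod 5) = 5 := Nat.card_zmod 5
    have h := isGeneralizedHexagon_splitCayley (F := ZMod 5)
    rw [hc] at h
    exact ⟨_, _, h⟩
  · intro V W H₄ H₅ h₄ h₅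
    have := IsBipartiteMoore.finite (by norm_num) h₄
    obtain ⟨r⟩ := IsBipartiteMoore.nonempty (by norm_num) h₄
    obtain ⟨g, X, hX⟩ := h₄.exists_isReplaceable r
    obtain ⟨σ, hσ⟩ := h₄.exists_isSlot hX
    have hG := hasOrderDegreeDiameter_substGraph h₄ hX hσ
    refine ⟨r, Set.range X, substGraph H₄ hX.injective σ, ?_, isSubstitution_substGraph h₄ hX hσ,
      hG, exists_compound hG h₅⟩
    rw [← Set.image_univ, Set.ncard_image_of_injective _ hX.injective, Set.ncard_univ,
      Nat.card_zmod]
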